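/- **Theorem 3.1.** Let $\Omega\subset\mathbb R^3$ be an open set (not necessarily bounded, no regularity of the boundary is assumed), $0<T<\infty$, $Q_T=\Omega\times{]0,T[}$, and $H=L^2(\Omega)^3$ with $(u,v)_H=\int_\Omega u\cdot v\,dx$. Let $V$ be the space of all $u\in H$ whose distributional curl is represented by an element $\operatorname{curl}u\in H$, i.e. $\int_\Omega u\cdot\operatorname{curl}\varphi\,dx=\int_\Omega(\operatorname{curl}u)\cdot\varphi\,dx$ for all $\varphi\in C_c^\infty(\Omega)^3$, with norm $\|u\|_V^2=\|u\|_H^2+\|\operatorname{curl}u\|_H^2$, and let $$V_0=\Big\{u\in V:\ \int_\Omega(\operatorname{curl}u)\cdot\psi\,dx=\int_\Omega u\cdot\operatorname{curl}\psi\,dx\ \text{ for all }\psi\in V\Big\}.$$ Assume: - (H1) the entries of the $3\times3$ matrices $\varepsilon(x)$, $\mu(x)$ are bounded measurable functions in $\Omega$; - (H2) $j(x,t,\xi)=j_0(x,t)+j_1(x,t,\xi)$, where $j_0\in L^2(Q_T)^3$ and $j_1:Q_T\times\mathbb R^3\to\mathbb R^3$ is a Carathéodory function, i.e. $(x,t)\mapsto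 j_1(x,t,\xi)$ is measurable in $Q_T$ for all $\xi\in\mathbb R^3$ and $\xi\mapsto j_1(x,t,\xi)$ is continuous in $\mathbb R^3$ for a.e. $(x,t)\in Q_T$; - (H3) there is a constant $c_1>0$ with $|j_1(x,t,\xi)|\le c_1|\xi|$ for all $(x,t,\xi)\in Q_T\times\mathbb R^3$; - (H4) $(e_0,h_0)\in L^2(\Omega)^3\times L^2(\Omega)^3$; - (H5) $\varepsilon(x)$ and $\mu(x)$ are symmetric for all $x\in\Omega$; - (H6) there are constants $\varepsilon_*>0$, $\mu_*>0$ with $\varepsilon(x)\xi\cdot\xi\ge\varepsilon_*|\xi|^2$ and $\mu(x)\xi\cdot\xi\ge\mu_*|\xi|^2$ for all $x\in\Omega$, $\xi\in\mathbb R^3$. Let $(e,h)\in L^2(Q_T)^3\times L^2(Q_T)^3$ be a weak solution of $$\partial_t(\varepsilon e)=\operatorname{curl}h-j(x,t,e),\quad \partial_t(\mu h)=-\operatorname{curl}e\ \text{ in }Q_T,\qquad n\times e=0\ \text{ on }\partial\Omega\times{]0,T[},\qquad e(0)=e_0,\ h(0)=h_0\ \text{ in }\Omega,$$ that is, $$-\int_{Q_T}(\varepsilon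 e)\cdot\partial_t\Phi\,dx\,dt+\int_{Q_T}\big(-h\cdot\operatorname{curl}\Phi+j(x,t,e)\cdot\Phi\big)\,dx\,dt=\int_\Omega(\varepsilon e_0)(x)\cdot\Phi(x,0)\,dx$$ for all $\Phi\in L^2(0,T;V_0)$ such that $\partial_t\Phi\in L^2(Q_T)^3$ and $\Phi(\cdot,T)=0$ a.e. in $\Omega$, and $$-\int_{Q_T}(\mu h)\cdot\partial_t\Psi\,dx\,dt+\int_{Q_T}e\cdot\operatorname{curl}\Psi\,dx\,dt=\int_\Omega(\mu h_0)(x)\cdot\Psi(x,0)\,dx$$ for all $\Psi\in L^2(0,T;V)$ such that $\partial_t\Psi\in L^2(Q_T)^3$ and $\Psi(\cdot,T)=0$ a.e. in $\Omega$. (Time derivatives are weak derivatives, and the values at $t=0$ and $t=T$ are those of the representatives of $\Phi$, $\Psi$ in $C([0,T];H)$.) Then, under the identification $L^2(Q_T)^3\cong L^2(0,T;H)$, there exist representatives $\hat e,\hat h\in C([0,T];H)$ in the equivalence classes $e,h$, respectively, i.e. $\hat e(t)=e(\cdot,t)$ and $\hat h(t)=h(\cdot,t)$ in $H$ for a.e.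 $t\in{]0,T[}$, and they satisfy the initial conditions $\hat e(0)=e_0$ and $\hat h(0)=h_0$ in $H$. -/

import Mathlib

open MeasureTheory Set
open scoped ContDiff RealInnerProductSpace

noncomputable section

namespace Maxwell

/-- Euclidean three-space. -/
abbrev E3 : Type := EuclideanSpace ℝ (Fin 3)

/-- The partial derivative `∂ᵢ φₖ` of a vector field `φ` at `x`. -/
def partialD (φ : E3 → E3) (i k : Fin 3) (x : E3) : ℝ :=
  (fderiv ℝ φ x (EuclideanSpace.single i 1)) k

/-- The classical curl of a vector field. -/
def curl (φ : E3 → E3) (x : E3) : E3 :=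
  !₂[partialD φ 1 2 x - partialD φ 2 1 x,
     partialD φ 2 0 x - partialD φ 0 2 x,
     partialD φ 0 1 x - partialD φ 1 0 x]

/-- `φ ∈ C_c^∞(Ω)³`. -/
structure IsTestVector (Ω : Set E3) (φ : E3 → E3) : Prop where
  contDiff : ContDiff ℝ ∞ φ
  hasCompactSupport : HasCompactSupport φ
  tsupport_subset : tsupport φ ⊆ Ω

/-- The Hilbert space `H = L²(Ω)³` with `(u,v)_H = ∫_Ω u · v dx`. -/
abbrev L2Field (Ω : Set E3) : Type := Lp E3 2 (volume.restrict Ω)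

/-- `F ∈ L²(Ω)³` represents the distribution `curl u`:
`∫_Ω u · curl φ dx = ∫_Ω F · φ dx` for all `φ ∈ C_c^∞(Ω)³`. -/
def IsWeakCurl (Ω : Set E3) (u F : L2Field Ω) : Prop :=
  ∀ φ : E3 → E3, IsTestVector Ω φ →
    ∫ x in Ω, ⟪u x, curl φ x⟫ = ∫ x in Ω, ⟪F x, φ x⟫

theorem IsTestVector.memLp {Ω : Set E3} {φ : E3 → E3} (h : IsTestVector Ω φ) :
    MemLp φ 2 (volume.restrict Ω) :=
  h.contDiff.continuous.memLp_of_hasCompactSupport h.hasCompactSupport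

theorem IsTestVector.memLp_curl {Ω : Set E3} {φ : E3 → E3} (h : IsTestVector Ω φ) :
    MemLp (curl φ) 2 (volume.restrict Ω) := by
  have hd : Continuous (fderiv ℝ φ) := h.contDiff.continuous_fderiv (by simp)
  have hp : ∀ i k, Continuous (partialD φ i k) := by
    intro i k
    unfold partialD
    fun_prop
  have hc : Continuous (curl φ) := by
    refine (PiLp.continuous_toLp 2 _).comp (continuous_pi fun i => ?_)
    fin_cases i <;> simp <;> fun_prop
  refine hc.memLp_of_hasCompactSupport ?_
  refine (h.hasCompactSupport.fderiv ℝ).mono fun x hx => ?_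
  contrapose! hx
  have h0 : fderiv ℝ φ x = 0 := by simpa using hx
  have : curl φ x = 0 := by
    ext i
    fin_cases i <;> simp [curl, partialD, h0]
  simpa using this

theorem isWeakCurl_zero (Ω : Set E3) : IsWeakCurl Ω 0 0 := by
  intro φ _
  have h0 := Lp.coeFn_zero E3 2 (volume.restrict Ω)
  rw [integral_eq_zero_of_ae, integral_eq_zero_of_ae]
  · filter_upwards [h0] with x hx
    rw [hx, Pi.zero_apply, inner_zero_left, Pi.zero_apply]
  · filter_upwards [h0] with x hx
    rw [hx, Pi.zero_apply, inner_zero_left, Pi.zero_apply]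

theorem IsWeakCurl.add {Ω : Set E3} {u v F G : L2Field Ω}
    (hu : IsWeakCurl Ω u F) (hv : IsWeakCurl Ω v G) : IsWeakCurl Ω (u + v) (F + G) := by
  intro φ hφ
  have key : ∀ (a b : L2Field Ω) (w : E3 → E3), MemLp w 2 (volume.restrict Ω) →
      ∫ x in Ω, ⟪(a + b) x, w x⟫ = (∫ x in Ω, ⟪a x, w x⟫) + ∫ x in Ω, ⟪b x, w x⟫ := by
    intro a b w hw
    have hint : ∀ a : L2Field Ω, Integrable (fun x => ⟪a x, w x⟫) (volume.restrict Ω) := by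
      intro a
      refine (L2.integrable_inner (𝕜 := ℝ) a hw.toLp).congr ?_
      filter_upwards [hw.coeFn_toLp] with x hx
      rw [hx]
    rw [← integral_add (hint a) (hint b)]
    refine integral_congr_ae ?_
    filter_upwards [Lp.coeFn_add a b] with x hx
    rw [hx, Pi.add_apply, inner_add_left]
  rw [key u v _ hφ.memLp_curl, key F G _ hφ.memLp]
  exact congrArg₂ (· + ·) (hu φ hφ) (hv φ hφ)

theorem IsWeakCurl.smul {Ω : Set E3} {u F : L2Field Ω} (c : ℝ)
    (hu : IsWeakCurl Ω u F) : IsWeakCurl Ω (c • u) (c • F) := by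
  intro φ hφ
  have key : ∀ (a : L2Field Ω) (w : E3 → E3),
      ∫ x in Ω, ⟪(c • a) x, w x⟫ = c * ∫ x in Ω, ⟪a x, w x⟫ := by
    intro a w
    rw [← integral_const_mul]
    refine integral_congr_ae ?_
    filter_upwards [Lp.coeFn_smul c a] with x hx
    rw [hx, Pi.smul_apply, real_inner_smul_left]
  rw [key, key, hu φ hφ]

/-- The space `V = H(curl; Ω)`. An element `u` is stored together with its (unique) weak curl
as the pair `(u, curl u) ∈ H × H`, so that the norm inherited from the Hilbert sum is the one
given by `(u,v)_V = ∫_Ω (u · v + curl u · curl v) dx`. -/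
def HCurl (Ω : Set E3) : Submodule ℝ (WithLp 2 (L2Field Ω × L2Field Ω)) where
  carrier := {p | IsWeakCurl Ω p.fst p.snd}
  zero_mem' := isWeakCurl_zero Ω
  add_mem' := fun hp hq => IsWeakCurl.add hp hq
  smul_mem' := fun c _ hp => IsWeakCurl.smul c hp

/-- The underlying `L²` field of an element of `V`. -/
def toField {Ω : Set E3} (u : HCurl Ω) : L2Field Ω := u.1.fst

/-- The weak curl of an element of `V`. -/
def wcurl {Ω : Set E3} (u : HCurl Ω) : L2Field Ω := u.1.snd

/-- The space `V₀` of all `u ∈ V` with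
`∫_Ω curl u · ψ dx = ∫_Ω u · curl ψ dx` for all `ψ ∈ V`. -/
def HCurlZero (Ω : Set E3) : Submodule ℝ (HCurl Ω) where
  carrier := {u | ∀ ψ : HCurl Ω, ⟪wcurl u, toField ψ⟫ = ⟪toField u, wcurl ψ⟫}
  zero_mem' := by
    intro ψ
    simp [wcurl, toField]
  add_mem' := by
    intro u v hu hv ψ
    have h1 := hu ψ
    have h2 := hv ψ
    simp only [wcurl, toField] at h1 h2 ⊢
    simp [inner_add_left, h1, h2]
  smul_mem' := by
    intro c u hu ψ
    have h1 := hu ψ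
    simp only [wcurl, toField] at h1 ⊢
    simp [real_inner_smul_left, h1]

/-- `U` is the derivative of `u` in the sense of distributions from `]0,T[` into `Y`. -/
def IsDistribDeriv {Y : Type*} [NormedAddCommGroup Y] [NormedSpace ℝ Y]
    (T : ℝ) (u U : ℝ → Y) : Prop :=
  ∀ ζ : ℝ → ℝ, ContDiff ℝ ∞ ζ → HasCompactSupport ζ → tsupport ζ ⊆ Ioo 0 T →
    ∫ t in Ioo 0 T, deriv ζ t • u t = -∫ t in Ioo 0 T, ζ t • U t

/-- `Φ ∈ L²(0,T;V)` with `∂ₜΦ ∈ L²(0,T;H) ≅ L²(Q_T)³` and `Φ(·,T) = 0`.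
`Φt` is the weak time derivative, and `Φc` is the representative of `Φ` in `C([0,T];H)`, which
gives the time traces `Φ(·,0) = Φc 0` and `Φ(·,T) = Φc T` their meaning. -/
structure IsTestField (Ω : Set E3) (T : ℝ)
    (Φ : ℝ → HCurl Ω) (Φt Φc : ℝ → L2Field Ω) : Prop where
  memLp : MemLp Φ 2 (volume.restrict (Ioo 0 T))
  memLp_deriv : MemLp Φt 2 (volume.restrict (Ioo 0 T))
  deriv : IsDistribDeriv T (fun t => toField (Φ t)) Φt
  continuousOn : ContinuousOn Φc (Icc 0 T)
  ae_eq : ∀ᵐ t ∂(volume.restrict (Ioo 0 T)), Φc t = toField (Φ t)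
  final : Φc T = 0

/-- The product of the matrix `A` and the vector `ξ`. -/
def mulE (A : Matrix (Fin 3) (Fin 3) ℝ) (ξ : E3) : E3 := Matrix.toEuclideanLin A ξ

/-- The space-time cylinder `Q_T = Ω × ]0,T[`. -/
def cylinder (Ω : Set E3) (T : ℝ) : Set (E3 × ℝ) := Ω ×ˢ Ioo 0 T

/-- `(e,h) ∈ L²(Q_T)³ × L²(Q_T)³` is a weak solution of
`∂ₜ(εe) = curl h - j₀ - j₁(e)`, `∂ₜ(μh) = -curl e` in `Q_T`, `n × e = 0` on `∂Ω × ]0,T[`,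
`e(0) = e₀`, `h(0) = h₀`. Integrals over `Q_T` are written as iterated integrals. -/
structure IsWeakSolution (Ω : Set E3) (T : ℝ) (ε μ : E3 → Matrix (Fin 3) (Fin 3) ℝ)
    (j₀ : E3 × ℝ → E3) (j₁ : E3 × ℝ → E3 → E3) (e₀ h₀ : L2Field Ω)
    (e h : E3 × ℝ → E3) : Prop where
  memLp_e : MemLp e 2 (volume.restrict (cylinder Ω T))
  memLp_h : MemLp h 2 (volume.restrict (cylinder Ω T))
  ampere : ∀ (Φ : ℝ → HCurl Ω) (Φt Φc : ℝ → L2Field Ω), IsTestField Ω T Φ Φt Φc →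
    (∀ᵐ t ∂(volume.restrict (Ioo 0 T)), Φ t ∈ HCurlZero Ω) →
      -(∫ t in Ioo 0 T, ∫ x in Ω, ⟪mulE (ε x) (e (x, t)), Φt t x⟫)
        + (∫ t in Ioo 0 T, ∫ x in Ω,
            (-⟪h (x, t), wcurl (Φ t) x⟫
              + ⟪j₀ (x, t) + j₁ (x, t) (e (x, t)), toField (Φ t) x⟫))
        = ∫ x in Ω, ⟪mulE (ε x) (e₀ x), Φc 0 x⟫
  faraday : ∀ (Ψ : ℝ → HCurl Ω) (Ψt Ψc : ℝ → L2Field Ω), IsTestField Ω T Ψ Ψt Ψc →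
      -(∫ t in Ioo 0 T, ∫ x in Ω, ⟪mulE (μ x) (h (x, t)), Ψt t x⟫)
        + (∫ t in Ioo 0 T, ∫ x in Ω, ⟪e (x, t), wcurl (Ψ t) x⟫)
        = ∫ x in Ω, ⟪mulE (μ x) (h₀ x), Ψc 0 x⟫

/-- The entries of the matrix function `A` are bounded measurable functions in `Ω`. -/
structure IsBoundedMeasurable (Ω : Set E3) (A : E3 → Matrix (Fin 3) (Fin 3) ℝ) : Prop where
  aemeasurable : ∀ i k, AEMeasurable (fun x => A x i k) (volume.restrict Ω)
  bounded : ∃ C : ℝ, ∀ x ∈ Ω, ∀ i k, |A x i k| ≤ C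

/-- `A(x)ξ · ξ ≥ a|ξ|²` on `Ω` for some constant `a > 0`. -/
def IsUniformlyElliptic (Ω : Set E3) (A : E3 → Matrix (Fin 3) (Fin 3) ℝ) : Prop :=
  ∃ a : ℝ, 0 < a ∧ ∀ x ∈ Ω, ∀ ξ : E3, a * ‖ξ‖ ^ 2 ≤ ⟪mulE (A x) ξ, ξ⟫

/-- `g` is a Carathéodory function on `Q × ℝ³`. -/
structure IsCaratheodory (Q : Set (E3 × ℝ)) (g : E3 × ℝ → E3 → E3) : Prop where
  aemeasurable : ∀ ξ : E3, AEMeasurable (fun p => g p ξ) (volume.restrict Q)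
  continuous : ∀ᵐ p ∂(volume.restrict Q), Continuous (g p)

end Maxwell

end

/-!
With `u = (e, h)`, `M = diag(ε, μ)`, `f = (j(·, e), 0)` and `A (e, h) = (curl h, -curl e)` on
`V₀ × V`, the system is the linear evolution equation `M u' = A u - f`, `u(0) = (e₀, h₀)`, in the
Hilbert space `L²(Ω)³ × L²(Ω)³`. Along the given solution `f` is a fixed source: the Carathéodory
and growth conditions only serve to put it into `L²` (`Maxwell.memLp_current`). Because `V₀` is
defined by duality, `A` is skew-adjoint (`Maxwell.isSkewAdjoint_maxwellGraph`), and its domain is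
dense because it contains the pairs of test fields.

The proof regularizes in space by the resolvents `R = (M - l A)⁻¹`, `l > 0`. They exist, are
bounded by the inverse of the coercivity constant, have the adjoints `(M + l A)⁻¹`, and
`R M → 1` strongly as `l → 0` (`Maxwell.tendsto_resolvent`). Testing the equation with
`ζ(t) R* ψ` shows that `R M u` agrees almost everywhere with a continuous function `w` with
`M w' = A w - M R f` and `w(0) = R M u₀` (`Maxwell.resolvent_solution_ae_eq`). In the energy
identity for the difference of two such functions (`Maxwell.inner_primitive_eq`) the skew operator
`A` drops out, so that this difference is controlled, uniformly on `[0, T]`, by the differences of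
`R M u₀` and of `R f`. Hence the `w` converge uniformly on `[0, T]`; the limit is continuous, agrees
with `u` almost everywhere and takes the value `u₀` at `0`
(`Maxwell.exists_continuous_representative`).
-/

namespace Maxwell

open Filter Topology

/-! ### Skew-adjoint relations and their weighted resolvents -/

section SkewAdjoint

variable {H : Type*} [NormedAddCommGroup H] [InnerProductSpace ℝ H]

/-- The linear relation `G`, thought of as the graph of an operator `A`, is skew-adjoint:
`A* = -A`, including the equality of the domains. -/
def IsSkewAdjoint (G : Submodule ℝ (H × H)) : Prop :=
  ∀ x y, (x, y) ∈ G ↔ ∀ a b, (a, b) ∈ G → ⟪y, a⟫ + ⟪x, b⟫ = 0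

theorem IsSkewAdjoint.inner_eq_zero {G : Submodule ℝ (H × H)} (hG : IsSkewAdjoint G)
    {x y : H} (h : (x, y) ∈ G) : ⟪y, x⟫ = 0 := by
  have := (hG x y).1 h x y h
  rw [real_inner_comm y x] at this
  linarith

theorem IsSkewAdjoint.isClosed {G : Submodule ℝ (H × H)} (hG : IsSkewAdjoint G) :
    IsClosed (G : Set (H × H)) := by
  have : (G : Set (H × H)) = ⋂ p ∈ G, {q : H × H | ⟪q.2, p.1⟫ + ⟪q.1, p.2⟫ = 0} := by
    ext ⟨x, y⟩
    simp only [SetLike.mem_coe, mem_iInter, mem_ofPred_eq, Prod.forall]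
    exact hG x y
  rw [this]
  refine isClosed_biInter fun p _ => isClosed_eq (by fun_prop) continuous_const

/-- If `⟪M x, x⟫ = ⟪g, x⟫`, which holds for `M x - l A x = g` with `A` skew, then `x` is bounded by
`g`. -/
theorem norm_le_of_coercive {M : H →L[ℝ] H} {m : ℝ} (hm : 0 < m)
    (hcoer : ∀ x, m * ‖x‖ ^ 2 ≤ ⟪M x, x⟫) {x g : H} (h : ⟪M x, x⟫ = ⟪g, x⟫) : ‖x‖ ≤ m⁻¹ * ‖g‖ := by
  rw [inv_mul_eq_div, le_div_iff₀ hm, mul_comm]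
  rcases eq_or_ne x 0 with h0 | h0
  · rw [h0]; simp
  · have h1 : 0 < ‖x‖ := norm_pos_iff.2 h0
    have h2 := real_inner_le_norm g x
    have h3 := hcoer x
    rw [h] at h3
    nlinarith

/-- `R` is the weighted resolvent `(M - l A)⁻¹`, where `G` is the graph of `A`: the point `R g`
lies in the domain of `A` and `A (R g) = l⁻¹ (M (R g) - g)`. -/
def IsResolvent (G : Submodule ℝ (H × H)) (M : H →L[ℝ] H) (l : ℝ) (R : H →L[ℝ] H) : Prop :=
  ∀ g, (R g, l⁻¹ • (M (R g) - g)) ∈ G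

variable [CompleteSpace H]

/-- The weighted resolvent `(M - l A)⁻¹` of a skew-adjoint operator `A` with graph `G`. -/
theorem IsSkewAdjoint.exists_resolvent {G : Submodule ℝ (H × H)} (hG : IsSkewAdjoint G)
    {M : H →L[ℝ] H} (hM : ∀ x y, ⟪M x, y⟫ = ⟪x, M y⟫) {m : ℝ} (hm : 0 < m)
    (hcoer : ∀ x, m * ‖x‖ ^ 2 ≤ ⟪M x, x⟫) {l : ℝ} (hl : l ≠ 0) :
    ∃ R : H →L[ℝ] H, IsResolvent G M l R := by
  have : CompleteSpace G := hG.isClosed.completeSpace_coe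
  let L : G →L[ℝ] H :=
    (M.comp (ContinuousLinearMap.fst ℝ H H) - l • ContinuousLinearMap.snd ℝ H H).comp G.subtypeL
  have hL : ∀ p : G, L p = M p.1.1 - l • p.1.2 := fun p => rfl
  -- Testing with `x` kills the skew-adjoint part, so that coercivity bounds `x`, hence also `A x`.
  have hb1 : ∀ p : G, ‖p.1.1‖ ≤ m⁻¹ * ‖L p‖ := by
    intro p
    refine norm_le_of_coercive hm hcoer ?_
    rw [hL, inner_sub_left, real_inner_smul_left, hG.inner_eq_zero p.2]; simp
  have hb2 : ∀ p : G, ‖p‖ ≤ max m⁻¹ (|l|⁻¹ * (‖M‖ * m⁻¹ + 1)) * ‖L p‖ := by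
    intro p
    have h1 := hb1 p
    have h2 : ‖p.1.2‖ ≤ |l|⁻¹ * (‖M‖ * m⁻¹ + 1) * ‖L p‖ := by
      have : p.1.2 = l⁻¹ • (M p.1.1 - L p) := by
        rw [hL, sub_sub_cancel, smul_smul, inv_mul_cancel₀ hl, one_smul]
      rw [this, norm_smul, norm_inv, Real.norm_eq_abs, mul_assoc]
      gcongr
      calc ‖M p.1.1 - L p‖ ≤ ‖M‖ * ‖p.1.1‖ + ‖L p‖ :=
            (norm_sub_le _ _).trans (by gcongr; exact M.le_opNorm _)
        _ ≤ ‖M‖ * (m⁻¹ * ‖L p‖) + ‖L p‖ := by gcongr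
        _ = _ := by ring
    refine max_le (h1.trans ?_) (h2.trans ?_)
    · gcongr; exact le_max_left _ _
    · gcongr; exact le_max_right _ _
  have hanti : AntilipschitzWith (max m⁻¹ (|l|⁻¹ * (‖M‖ * m⁻¹ + 1))).toNNReal L := by
    refine ContinuousLinearMap.antilipschitz_of_bound _ fun p => ?_
    rw [Real.coe_toNNReal _ (le_max_of_le_left (by positivity))]
    exact hb2 p
  have hinj : L.ker = ⊥ := LinearMap.ker_eq_bot.2 hanti.injective
  have hcl : IsClosed (L.range : Set H) := hanti.isClosed_range L.uniformContinuous
  have hsurj : L.range = ⊤ := by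
    have : CompleteSpace L.range := hcl.completeSpace_coe
    rw [← Submodule.orthogonal_eq_bot_iff, Submodule.eq_bot_iff]
    -- A vector `g` orthogonal to the range lies in the domain of `A* = -A`, with `A g = -l⁻¹ M g`,
    -- so that coercivity forces `g = 0`.
    intro g hg
    have h1 : ∀ a b, (a, b) ∈ G → ⟪M g, a⟫ - l * ⟪g, b⟫ = 0 := by
      intro a b hab
      have := (Submodule.mem_orthogonal' _ _).1 hg (L ⟨(a, b), hab⟩) ⟨_, rfl⟩
      rw [hL, inner_sub_right, real_inner_smul_right, ← hM] at this
      exact this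
    have h2 : (g, -(l⁻¹ • M g)) ∈ G := by
      rw [hG]
      intro a b hab
      have := h1 a b hab
      rw [inner_neg_left, real_inner_smul_left]
      field_simp
      linarith
    have h3 := hG.inner_eq_zero h2
    rw [inner_neg_left, real_inner_smul_left, neg_eq_zero, mul_eq_zero] at h3
    have h4 := h3.resolve_left (inv_ne_zero hl)
    have h5 := hcoer g
    rw [h4] at h5
    have : ‖g‖ ^ 2 ≤ 0 := by nlinarith
    simpa using this
  let E := ContinuousLinearEquiv.ofBijective L hinj hsurj
  refine ⟨((ContinuousLinearMap.fst ℝ H H).comp G.subtypeL).comp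
    (E.symm : H →L[ℝ] G), fun g => ?_⟩
  have h1 : L (E.symm g) = g := ContinuousLinearEquiv.ofBijective_apply_symm_apply L hinj hsurj g
  rw [hL] at h1
  have h2 : l⁻¹ • (M (E.symm g).1.1 - g) = (E.symm g).1.2 := by
    nth_rewrite 2 [← h1]
    rw [sub_sub_cancel, smul_smul, inv_mul_cancel₀ hl, one_smul]
  change ((E.symm g).1.1, l⁻¹ • (M (E.symm g).1.1 - g)) ∈ G
  rw [h2]
  exact (E.symm g).2

end SkewAdjoint

section Resolvent

variable {H : Type*} [NormedAddCommGroup H] [InnerProductSpace ℝ H]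
  {G : Submodule ℝ (H × H)} {M : H →L[ℝ] H} {m : ℝ}

theorem IsResolvent.norm_le {l : ℝ} {R : H →L[ℝ] H} (hR : IsResolvent G M l R)
    (hG : IsSkewAdjoint G) (hm : 0 < m) (hcoer : ∀ x, m * ‖x‖ ^ 2 ≤ ⟪M x, x⟫) (hl : l ≠ 0) (g : H) :
    ‖R g‖ ≤ m⁻¹ * ‖g‖ := by
  refine norm_le_of_coercive hm hcoer ?_
  have := hG.inner_eq_zero (hR g)
  rw [real_inner_smul_left, mul_eq_zero, inner_sub_left] at this
  linarith [this.resolve_left (inv_ne_zero hl)]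

/-- The adjoint of `(M - l A)⁻¹` is `(M + l A)⁻¹`. -/
theorem IsResolvent.inner_left {l : ℝ} {R R' : H →L[ℝ] H} (hR : IsResolvent G M l R)
    (hR' : IsResolvent G M (-l) R') (hG : IsSkewAdjoint G)
    (hM : ∀ x y, ⟪M x, y⟫ = ⟪x, M y⟫) (hl : l ≠ 0) (g k : H) : ⟪R g, k⟫ = ⟪g, R' k⟫ := by
  have := (hG _ _).1 (hR g) _ _ (hR' k)
  simp only [inner_sub_left, inner_sub_right, real_inner_smul_left, real_inner_smul_right, hM,
    inv_neg, neg_mul] at this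
  have h2 : l⁻¹ * (⟪R g, k⟫ - ⟪g, R' k⟫) = 0 := by linarith
  have := (mul_eq_zero.1 h2).resolve_left (inv_ne_zero hl)
  linarith

theorem IsResolvent.apply_eq {l : ℝ} {R : H →L[ℝ] H} (hR : IsResolvent G M l R)
    (hG : IsSkewAdjoint G) (hm : 0 < m) (hcoer : ∀ x, m * ‖x‖ ^ 2 ≤ ⟪M x, x⟫) (hl : l ≠ 0)
    {a b : H} (hab : (a, b) ∈ G) : R (M a - l • b) = a := by
  obtain ⟨g, hg⟩ : ∃ g, g = M a - l • b := ⟨_, rfl⟩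
  rw [← hg]
  have hb : l⁻¹ • (M a - g) = b := by
    rw [hg, sub_sub_cancel, smul_smul, inv_mul_cancel₀ hl, one_smul]
  have h1 := G.sub_mem (hR g) hab
  have h2 : ⟪l⁻¹ • (M (R g) - g) - b, R g - a⟫ = 0 := hG.inner_eq_zero h1
  have h3 : l⁻¹ • (M (R g) - g) - b = l⁻¹ • M (R g - a) := by
    rw [← hb, ← smul_sub, map_sub]
    congr 1
    abel
  rw [h3, real_inner_smul_left, mul_eq_zero] at h2
  have h4 := h2.resolve_left (inv_ne_zero hl)
  have h5 := norm_le_of_coercive (g := 0) hm hcoer (h4.trans (inner_zero_left _).symm)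
  rw [norm_zero, mul_zero, norm_le_zero_iff, sub_eq_zero] at h5
  exact h5

/-- `(M - l A)⁻¹ M → 1` strongly as `l → 0`. On the domain of `A` this follows from
`R (M a) - a = l R (A a)`, and the uniform bound of the resolvents extends it to the closure. -/
theorem tendsto_resolvent (hG : IsSkewAdjoint G) (hm : 0 < m)
    (hcoer : ∀ x, m * ‖x‖ ^ 2 ≤ ⟪M x, x⟫) (hdense : Dense {a | ∃ b, (a, b) ∈ G})
    {l : ℕ → ℝ} (hl : ∀ n, 0 < l n) (hl0 : Tendsto l atTop (𝓝 0)) {R : ℕ → H →L[ℝ] H}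
    (hR : ∀ n, IsResolvent G M (l n) (R n)) (v : H) :
    Tendsto (fun n => R n (M v)) atTop (𝓝 v) := by
  rw [Metric.tendsto_atTop]
  intro ε hε
  set K := m⁻¹ * ‖M‖ + 1 with hK
  have hKpos : 0 < K := by positivity
  obtain ⟨a, ⟨b, hab⟩, ha⟩ := Metric.mem_closure_iff.1 (hdense v) (ε / (2 * K)) (by positivity)
  rw [dist_eq_norm] at ha
  have h1 : Tendsto (fun n => l n * (m⁻¹ * ‖b‖)) atTop (𝓝 0) := by
    simpa using hl0.mul_const (m⁻¹ * ‖b‖)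
  obtain ⟨N, hN⟩ := Metric.tendsto_atTop.1 h1 (ε / 2) (by positivity)
  refine ⟨N, fun n hn => ?_⟩
  have h2 := hN n hn
  rw [Real.dist_0_eq_abs, abs_of_nonneg (mul_nonneg (hl n).le (by positivity))] at h2
  have hb : ∀ g, ‖R n g‖ ≤ m⁻¹ * ‖g‖ := (hR n).norm_le hG hm hcoer (hl n).ne'
  have h3 : R n (M v) - v = R n (M (v - a)) - (v - a) + l n • R n b := by
    have := (hR n).apply_eq hG hm hcoer (hl n).ne' hab
    rw [map_sub, map_smul] at this
    rw [map_sub, map_sub, ← sub_eq_zero]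
    rw [sub_eq_iff_eq_add] at this
    rw [this]; abel
  rw [dist_eq_norm, h3]
  calc ‖R n (M (v - a)) - (v - a) + l n • R n b‖
      ≤ ‖R n (M (v - a))‖ + ‖v - a‖ + ‖l n • R n b‖ :=
        (norm_add_le _ _).trans (by gcongr; exact norm_sub_le _ _)
    _ ≤ m⁻¹ * (‖M‖ * ‖v - a‖) + ‖v - a‖ + l n * (m⁻¹ * ‖b‖) := by
        rw [norm_smul, Real.norm_of_nonneg (hl n).le]
        have := (hl n).le
        gcongr
        · exact (hb _).trans (by gcongr; exact M.le_opNorm _)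
        · exact hb _
    _ = K * ‖v - a‖ + l n * (m⁻¹ * ‖b‖) := by rw [hK]; ring
    _ < K * (ε / (2 * K)) + ε / 2 := by gcongr
    _ = ε := by field_simp; ring

end Resolvent

/-! ### The energy identity -/

section Energy

variable {H : Type*} [NormedAddCommGroup H] [InnerProductSpace ℝ H] [CompleteSpace H]
  {M : H →L[ℝ] H}

/-- Absolute continuity passes to functions whose increments are dominated by those of an
absolutely continuous function, possibly with values in another space. -/
theorem absolutelyContinuousOnInterval_of_dist_le {X Y : Type*} [PseudoMetricSpace X]
    [PseudoMetricSpace Y] {f : ℝ → X} {g : ℝ → Y} {a b C : ℝ}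
    (hg : AbsolutelyContinuousOnInterval g a b)
    (h : ∀ s ∈ uIcc a b, ∀ t ∈ uIcc a b, dist (f s) (f t) ≤ C * dist (g s) (g t)) :
    AbsolutelyContinuousOnInterval f a b := by
  unfold AbsolutelyContinuousOnInterval at hg ⊢
  refine squeeze_zero' (.of_forall fun _ => Finset.sum_nonneg fun _ _ => dist_nonneg) ?_
    (by simpa using hg.const_mul C)
  rw [eventually_inf_principal]
  filter_upwards with E hE
  rw [Finset.mul_sum]
  exact Finset.sum_le_sum fun i hi => h _ (hE.1 i hi).1 _ (hE.1 i hi).2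

/-- Energy identity: `d/dt ⟪M w, w⟫ = 2 ⟪M w', w⟫` for the primitive `w` of an integrable
function. -/
theorem inner_primitive_eq (hM : ∀ x y, ⟪M x, y⟫ = ⟪x, M y⟫) {T : ℝ} (hT : 0 ≤ T) {g w : ℝ → H}
    (hg : IntervalIntegrable g volume 0 T) {w₀ : H} (hw : ∀ t, w t = w₀ + ∫ s in 0..t, g s)
    {t : ℝ} (ht : t ∈ Icc 0 T) :
    ⟪M (w t), w t⟫ = ⟪M w₀, w₀⟫ + 2 * ∫ s in 0..t, ⟪M (g s), w s⟫ := by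
  have hsub : uIcc 0 t ⊆ uIcc 0 T := by
    rw [uIcc_of_le ht.1, uIcc_of_le hT]; exact Icc_subset_Icc_right ht.2
  have hgt : IntervalIntegrable g volume 0 t := hg.mono_set hsub
  have hgi : ∀ a ∈ uIcc 0 t, ∀ b ∈ uIcc 0 t, IntervalIntegrable g volume a b := fun a ha b hb =>
    hgt.mono_set (uIcc_subset_uIcc ha hb)
  have hcont : ContinuousOn w (uIcc 0 t) := by
    have : w = fun t => w₀ + ∫ s in 0..t, g s := funext hw
    rw [this]
    exact continuousOn_const.add (intervalIntegral.continuousOn_primitive_interval' hgt (by simp))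
  obtain ⟨K, hK⟩ := isCompact_uIcc.exists_bound_of_continuousOn hcont
  have hK0 : 0 ≤ K := (norm_nonneg _).trans (hK 0 (by simp))
  set N : ℝ → ℝ := fun s => ⟪M (w s), w s⟫ with hN
  have hac : AbsolutelyContinuousOnInterval N 0 t := by
    refine absolutelyContinuousOnInterval_of_dist_le (C := 2 * (‖M‖ * K))
      (hgt.norm.absolutelyContinuousOnInterval_intervalIntegral (c := 0) (by simp)) ?_
    intro a ha b hb
    have h1 : N a - N b = ⟪M (w a), w a - w b⟫ + ⟪M (w a - w b), w b⟫ := by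
      simp only [hN, map_sub, inner_sub_left, inner_sub_right]; ring
    have h2 : ‖w a - w b‖ ≤ |(∫ s in 0..a, ‖g s‖) - ∫ s in 0..b, ‖g s‖| := by
      rw [hw, hw, add_sub_add_left_eq_sub,
        intervalIntegral.integral_interval_sub_left (hgi _ (by simp) _ ha) (hgi _ (by simp) _ hb),
        intervalIntegral.integral_interval_sub_left (hgi _ (by simp) _ ha).norm
          (hgi _ (by simp) _ hb).norm]
      exact intervalIntegral.norm_integral_le_abs_integral_norm
    rw [Real.dist_eq, Real.dist_eq, h1]
    calc |⟪M (w a), w a - w b⟫ + ⟪M (w a - w b), w b⟫|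
        ≤ ‖M (w a)‖ * ‖w a - w b‖ + ‖M (w a - w b)‖ * ‖w b‖ :=
          (abs_add_le _ _).trans (add_le_add (abs_real_inner_le_norm _ _)
            (abs_real_inner_le_norm _ _))
      _ ≤ (‖M‖ * K) * ‖w a - w b‖ + (‖M‖ * ‖w a - w b‖) * K := by
          gcongr
          · exact (M.le_opNorm _).trans (by gcongr; exact hK a ha)
          · exact M.le_opNorm _
          · exact hK b hb
      _ = 2 * (‖M‖ * K) * ‖w a - w b‖ := by ring
      _ ≤ _ := by gcongr
  have hFTC := hac.integral_deriv_eq_sub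
  -- At almost every point `w` is differentiable with derivative `g` (Lebesgue differentiation).
  have hderiv : ∫ s in 0..t, deriv N s = ∫ s in 0..t, 2 * ⟪M (g s), w s⟫ := by
    refine intervalIntegral.integral_congr_ae ?_
    filter_upwards [hgt.ae_hasDerivAt_integral] with s hs hs'
    have h1 : HasDerivAt w (g s) s := by
      have : w = fun t => w₀ + ∫ s in 0..t, g s := funext hw
      rw [this]
      exact (hs (uIoc_subset_uIcc hs') 0 (by simp)).const_add w₀
    have h2 := ((M.hasFDerivAt.comp_hasDerivAt s h1).inner ℝ h1).deriv
    have h3 : deriv N s = ⟪M (w s), g s⟫ + ⟪M (g s), w s⟫ := h2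
    rw [h3, hM, real_inner_comm]; ring
  rw [hderiv, intervalIntegral.integral_const_mul] at hFTC
  have h0 : w 0 = w₀ := by rw [hw]; simp
  simp only [hN, h0] at hFTC
  linarith

/-- If `M w' = A w - M r` with `A` skew, then the size of `w` is controlled by the
initial value and by `r`. -/
theorem norm_le_of_energy (hM : ∀ x y, ⟪M x, y⟫ = ⟪x, M y⟫) {m : ℝ} (hm : 0 < m)
    (hcoer : ∀ x, m * ‖x‖ ^ 2 ≤ ⟪M x, x⟫) {T : ℝ} (hT : 0 ≤ T) {g w r : ℝ → H}
    (hg : IntervalIntegrable g volume 0 T) (hr : IntervalIntegrable r volume 0 T) {w₀ : H}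
    (hw : ∀ t, w t = w₀ + ∫ s in 0..t, g s)
    (hgr : ∀ᵐ t ∂volume.restrict (Ioc 0 T), ⟪M (g t), w t⟫ = -⟪M (r t), w t⟫)
    {t : ℝ} (ht : t ∈ Icc 0 T) :
    ‖w t‖ ≤ m⁻¹ * ‖M‖ * (‖w₀‖ + 2 * ∫ s in 0..T, ‖r s‖) := by
  have hcont : ContinuousOn w (Icc 0 T) := by
    have : w = fun t => w₀ + ∫ s in 0..t, g s := funext hw
    rw [this, ← uIcc_of_le hT]
    exact continuousOn_const.add (intervalIntegral.continuousOn_primitive_interval' hg (by simp))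
  obtain ⟨τ, hτ, hmax⟩ := isCompact_Icc.exists_isMaxOn (nonempty_Icc.2 hT) hcont.norm
  have hmax' : ∀ s ∈ Icc 0 T, ‖w s‖ ≤ ‖w τ‖ := hmax
  refine (hmax' t ht).trans ?_
  have h0 : w 0 = w₀ := by rw [hw]; simp
  have h0' : ‖w₀‖ ≤ ‖w τ‖ := h0 ▸ hmax' 0 ⟨le_rfl, hT⟩
  have hE := inner_primitive_eq hM hT hg hw hτ
  have hr0 : 0 ≤ ∫ s in 0..T, ‖r s‖ := intervalIntegral.integral_nonneg hT fun _ _ => norm_nonneg _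
  have hI : ∫ s in 0..τ, ⟪M (g s), w s⟫ ≤ ‖M‖ * ‖w τ‖ * ∫ s in 0..T, ‖r s‖ := by
    have h1 : ‖∫ s in 0..τ, ⟪M (g s), w s⟫‖ ≤ ∫ s in 0..τ, ‖M‖ * ‖w τ‖ * ‖r s‖ := by
      refine intervalIntegral.norm_integral_le_of_norm_le hτ.1 ?_ ?_
      · filter_upwards [(ae_restrict_iff' measurableSet_Ioc).1 hgr] with s hs hs'
        have hsT : s ∈ Ioc 0 T := ⟨hs'.1, hs'.2.trans hτ.2⟩
        rw [hs hsT, norm_neg]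
        calc ‖⟪M (r s), w s⟫‖ ≤ ‖M (r s)‖ * ‖w s‖ := norm_inner_le_norm _ _
          _ ≤ (‖M‖ * ‖r s‖) * ‖w τ‖ := by
            gcongr
            · exact M.le_opNorm _
            · exact hmax' s ⟨hsT.1.le, hsT.2⟩
          _ = _ := by ring
      · refine ((hr.mono_set ?_).norm).const_mul _
        rw [uIcc_of_le hτ.1, uIcc_of_le hT]; exact Icc_subset_Icc_right hτ.2
    rw [intervalIntegral.integral_const_mul] at h1
    refine (le_abs_self _).trans (h1.trans ?_)
    gcongr
    exact intervalIntegral.integral_mono_interval le_rfl hτ.1 hτ.2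
      (.of_forall fun _ => norm_nonneg _) hr.norm
  have h1 : ⟪M w₀, w₀⟫ ≤ ‖M‖ * ‖w₀‖ * ‖w τ‖ := by
    refine (real_inner_le_norm _ _).trans ?_
    gcongr
    exact M.le_opNorm _
  have h2 : m * ‖w τ‖ ^ 2 ≤ (‖M‖ * (‖w₀‖ + 2 * ∫ s in 0..T, ‖r s‖)) * ‖w τ‖ := by
    refine (hcoer _).trans ?_
    rw [hE]; nlinarith
  rcases eq_or_ne (w τ) 0 with h | h
  · rw [h, norm_zero]; positivity
  · have hpos : 0 < ‖w τ‖ := norm_pos_iff.2 h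
    rw [mul_assoc, inv_mul_eq_div, le_div_iff₀ hm]
    nlinarith

end Energy

/-! ### Abstract evolution equations -/

section Evolution

variable {H : Type*} [NormedAddCommGroup H] [InnerProductSpace ℝ H]
  {G : Submodule ℝ (H × H)} {M : H →L[ℝ] H} {m : ℝ}

/-- The sources `R f` of the regularized problems converge to `M⁻¹ f` in `L¹`. -/
theorem tendsto_integral_resolvent_sub (hG : IsSkewAdjoint G) (hm : 0 < m)
    (hcoer : ∀ x, m * ‖x‖ ^ 2 ≤ ⟪M x, x⟫) (hdense : Dense {a | ∃ b, (a, b) ∈ G})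
    {l : ℕ → ℝ} (hl : ∀ n, 0 < l n) (hl0 : Tendsto l atTop (𝓝 0)) {R : ℕ → H →L[ℝ] H}
    (hR : ∀ n, IsResolvent G M (l n) (R n)) {N : H →L[ℝ] H} (hN : ∀ g, M (N g) = g)
    {T : ℝ} {f : ℝ → H} (hf : IntervalIntegrable f volume 0 T) :
    Tendsto (fun n => ∫ s in 0..T, ‖R n (f s) - N (f s)‖) atTop (𝓝 0) := by
  have h := intervalIntegral.tendsto_integral_filter_of_dominated_convergence (μ := volume)
    (a := 0) (b := T) (l := atTop) (F := fun n s => ‖R n (f s) - N (f s)‖) (f := fun _ => (0 : ℝ))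
    (fun s => (m⁻¹ + ‖N‖) * ‖f s‖) ?_ ?_ (hf.norm.const_mul _) ?_
  · simpa using h
  · refine .of_forall fun n => ?_
    have := hf.aestronglyMeasurable_restrict_uIoc
    exact (((R n).continuous.comp_aestronglyMeasurable this).sub
      (N.continuous.comp_aestronglyMeasurable this)).norm
  · refine .of_forall fun n => .of_forall fun s _ => ?_
    rw [norm_norm, add_mul]
    refine (norm_sub_le _ _).trans (add_le_add ?_ (N.le_opNorm _))
    exact (hR n).norm_le hG hm hcoer (hl n).ne' _
  · refine .of_forall fun s _ => ?_
    have h1 := tendsto_resolvent hG hm hcoer hdense hl hl0 hR (N (f s))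
    rw [hN] at h1
    have := (h1.sub_const (N (f s))).norm
    simpa using this

variable [CompleteSpace H]

theorem exists_rightInverse_of_coercive (hm : 0 < m) (hcoer : ∀ x, m * ‖x‖ ^ 2 ≤ ⟪M x, x⟫) :
    ∃ N : H →L[ℝ] H, ∀ g, M (N g) = g := by
  have hanti : AntilipschitzWith (m⁻¹).toNNReal M := by
    refine ContinuousLinearMap.antilipschitz_of_bound _ fun p => ?_
    rw [Real.coe_toNNReal _ (by positivity)]
    exact norm_le_of_coercive hm hcoer rfl
  have hinj : M.ker = ⊥ := LinearMap.ker_eq_bot.2 hanti.injective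
  have hcl : IsClosed (M.range : Set H) := hanti.isClosed_range M.uniformContinuous
  have hsurj : M.range = ⊤ := by
    have : CompleteSpace M.range := hcl.completeSpace_coe
    rw [← Submodule.orthogonal_eq_bot_iff, Submodule.eq_bot_iff]
    intro g hg
    have h1 : ⟪M g, g⟫ = 0 := (Submodule.mem_orthogonal _ _).1 hg (M g) ⟨_, rfl⟩
    have h2 := norm_le_of_coercive (g := 0) hm hcoer (h1.trans (inner_zero_left _).symm)
    rwa [norm_zero, mul_zero, norm_le_zero_iff] at h2
  exact ⟨(ContinuousLinearEquiv.ofBijective M hinj hsurj).symm,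
    fun g => ContinuousLinearEquiv.ofBijective_apply_symm_apply M hinj hsurj g⟩

variable [SecondCountableTopology H]

/-- The regularized solution `R M u`, with `R = (M - l A)⁻¹`, agrees almost everywhere with a
primitive. The weak equation is tested with `R* ψ`, which belongs to the domain of `A`. -/
theorem resolvent_solution_ae_eq (hG : IsSkewAdjoint G) (hM : ∀ x y, ⟪M x, y⟫ = ⟪x, M y⟫)
    {l : ℝ} (hl : l ≠ 0) {R R' : H →L[ℝ] H} (hR : IsResolvent G M l R)
    (hR' : IsResolvent G M (-l) R') {T : ℝ} (hT : 0 ≤ T) {u f : ℝ → H}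
    (hu : IntervalIntegrable u volume 0 T) (hf : IntervalIntegrable f volume 0 T) {u₀ : H}
    (hweak : ∀ a b, (a, b) ∈ G → ∀ᵐ t ∂volume.restrict (Ioc 0 T),
      ⟪M (u t), a⟫ = ⟪M u₀, a⟫ - ∫ s in 0..t, (⟪u s, b⟫ + ⟪f s, a⟫)) :
    ∀ᵐ t ∂volume.restrict (Ioc 0 T), R (M (u t)) =
      R (M u₀) + ∫ s in 0..t, (l⁻¹ • (R (M (u s)) - u s) - R (f s)) := by
  have key : ∀ ψ : H, (fun t => ⟪ψ, R (M (u t)) -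
      (R (M u₀) + ∫ s in 0..t, (l⁻¹ • (R (M (u s)) - u s) - R (f s)))⟫)
        =ᵐ[volume.restrict (Ioc 0 T)] 0 := by
    intro ψ
    filter_upwards [hweak _ _ (hR' ψ), ae_restrict_mem measurableSet_Ioc] with t ht htT
    have hsub : uIcc 0 t ⊆ uIcc 0 T := by
      rw [uIcc_of_le htT.1.le, uIcc_of_le hT]; exact Icc_subset_Icc_right htT.2
    have hadj : ∀ g, ⟪R g, ψ⟫ = ⟪g, R' ψ⟫ := fun g => hR.inner_left hR' hG hM hl g ψ
    have hu' := hu.mono_set hsub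
    have hf' := hf.mono_set hsub
    have hRu : IntervalIntegrable (fun s => R (M (u s))) volume 0 t :=
      ⟨(R.comp M).integrable_comp hu'.1, (R.comp M).integrable_comp hu'.2⟩
    have hRf : IntervalIntegrable (fun s => R (f s)) volume 0 t :=
      ⟨R.integrable_comp hf'.1, R.integrable_comp hf'.2⟩
    have hint : IntervalIntegrable (fun s => l⁻¹ • (R (M (u s)) - u s) - R (f s)) volume 0 t :=
      ((hRu.sub hu').smul l⁻¹).sub hRf
    have hpull : ⟪ψ, ∫ s in 0..t, (l⁻¹ • (R (M (u s)) - u s) - R (f s))⟫ =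
        ∫ s in 0..t, ⟪ψ, l⁻¹ • (R (M (u s)) - u s) - R (f s)⟫ :=
      ((innerSL ℝ ψ).intervalIntegral_comp_comm hint).symm
    rw [inner_sub_right, inner_add_right, hpull, real_inner_comm, hadj, real_inner_comm (R (M u₀)),
      hadj, ht, Pi.zero_apply, sub_eq_zero, sub_eq_add_neg, ← intervalIntegral.integral_neg]
    congr 1
    refine intervalIntegral.integral_congr fun s _ => ?_
    rw [real_inner_comm _ ψ, inner_sub_left, real_inner_smul_left, inner_sub_left, hadj, hadj,
      real_inner_smul_right, inner_sub_right, ← hM, inv_neg]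
    ring
  filter_upwards [ae_eq_zero_of_forall_inner (𝕜 := ℝ) key] with t ht
  exact sub_eq_zero.1 ht

/-- A weak solution of `M u' = A u - f`, `u(0) = u₀`, with `A` skew-adjoint and `M` bounded,
symmetric and coercive, has a continuous representative that attains the initial value. -/
theorem exists_continuous_representative (hG : IsSkewAdjoint G)
    (hM : ∀ x y, ⟪M x, y⟫ = ⟪x, M y⟫) (hm : 0 < m)
    (hcoer : ∀ x, m * ‖x‖ ^ 2 ≤ ⟪M x, x⟫) (hdense : Dense {a | ∃ b, (a, b) ∈ G})
    {T : ℝ} (hT : 0 ≤ T) {u f : ℝ → H}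
    (hu : IntervalIntegrable u volume 0 T) (hf : IntervalIntegrable f volume 0 T) {u₀ : H}
    (hweak : ∀ a b, (a, b) ∈ G → ∀ᵐ t ∂volume.restrict (Ioc 0 T),
      ⟪M (u t), a⟫ = ⟪M u₀, a⟫ - ∫ s in 0..t, (⟪u s, b⟫ + ⟪f s, a⟫)) :
    ∃ v : ℝ → H, ContinuousOn v (Icc 0 T) ∧
      (∀ᵐ t ∂volume.restrict (Ioc 0 T), v t = u t) ∧ v 0 = u₀ := by
  set l : ℕ → ℝ := fun n => 1 / ((n : ℝ) + 1) with hl_def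
  have hl : ∀ n, 0 < l n := fun n => by positivity
  have hl0 : Tendsto l atTop (𝓝 0) := tendsto_one_div_add_atTop_nhds_zero_nat
  choose R hR using fun n => hG.exists_resolvent hM hm hcoer (hl n).ne'
  choose R' hR' using fun n => hG.exists_resolvent hM hm hcoer (neg_ne_zero.2 (hl n).ne')
  obtain ⟨N, hN⟩ := exists_rightInverse_of_coercive hm hcoer
  set g : ℕ → ℝ → H := fun n s => (l n)⁻¹ • (R n (M (u s)) - u s) - R n (f s) with hg_def
  set w : ℕ → ℝ → H := fun n t => R n (M u₀) + ∫ s in 0..t, g n s with hw_def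
  have hRu : ∀ n, IntervalIntegrable (fun s => R n (M (u s))) volume 0 T := fun n =>
    ⟨((R n).comp M).integrable_comp hu.1, ((R n).comp M).integrable_comp hu.2⟩
  have hRf : ∀ n, IntervalIntegrable (fun s => R n (f s)) volume 0 T := fun n =>
    ⟨(R n).integrable_comp hf.1, (R n).integrable_comp hf.2⟩
  have hNf : IntervalIntegrable (fun s => N (f s)) volume 0 T :=
    ⟨N.integrable_comp hf.1, N.integrable_comp hf.2⟩
  have hgi : ∀ n, IntervalIntegrable (g n) volume 0 T := fun n =>
    (((hRu n).sub hu).smul _).sub (hRf n)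
  have hwu : ∀ᵐ t ∂volume.restrict (Ioc 0 T), ∀ n, R n (M (u t)) = w n t :=
    ae_all_iff.2 fun n =>
      resolvent_solution_ae_eq hG hM (hl n).ne' (hR n) (hR' n) hT hu hf hweak
  have hres := tendsto_resolvent hG hm hcoer hdense hl hl0 hR
  -- The distance of the data of the regularized problems from those of the original one.
  set δ : ℕ → ℝ := fun n => m⁻¹ * ‖M‖ *
    (‖R n (M u₀) - u₀‖ + 2 * ∫ s in 0..T, ‖R n (f s) - N (f s)‖) with hδ_def
  have hδ : Tendsto δ atTop (𝓝 0) := by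
    have h1 := ((hres u₀).sub_const u₀).norm
    have h2 := tendsto_integral_resolvent_sub hG hm hcoer hdense hl hl0 hR hN hf
    simpa using (h1.add (h2.const_mul 2)).const_mul (m⁻¹ * ‖M‖)
  have hdiff : ∀ n k, ∀ t ∈ Icc 0 T, ‖w n t - w k t‖ ≤ δ n + δ k := by
    intro n k t ht
    have hprim : ∀ t ∈ Icc 0 T, w n t - w k t =
        (R n (M u₀) - R k (M u₀)) + ∫ s in 0..t, (g n s - g k s) := by
      intro t ht
      have hsub : uIcc 0 t ⊆ uIcc 0 T := by
        rw [uIcc_of_le ht.1, uIcc_of_le hT]; exact Icc_subset_Icc_right ht.2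
      rw [intervalIntegral.integral_sub ((hgi n).mono_set hsub) ((hgi k).mono_set hsub)]
      simp only [hw_def]; abel
    have hae : ∀ᵐ t ∂volume.restrict (Ioc 0 T),
        ⟪M (g n t - g k t), (R n (M u₀) - R k (M u₀)) + ∫ s in 0..t, (g n s - g k s)⟫ =
        -⟪M (R n (f t) - R k (f t)), (R n (M u₀) - R k (M u₀)) + ∫ s in 0..t, (g n s - g k s)⟫ := by
      filter_upwards [hwu, ae_restrict_mem measurableSet_Ioc] with t h1 htT
      rw [← hprim t ⟨htT.1.le, htT.2⟩, ← h1, ← h1]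
      have h2 := hG.inner_eq_zero (G.sub_mem (hR n (M (u t))) (hR k (M (u t))))
      have h3 : M (g n t - g k t) + M (R n (f t) - R k (f t)) =
          ((l n)⁻¹ • (M (R n (M (u t))) - M (u t))) -
            ((l k)⁻¹ • (M (R k (M (u t))) - M (u t))) := by
        simp only [hg_def, map_sub, map_smul]; abel
      rw [← h3, inner_add_left] at h2
      linarith
    have hb := norm_le_of_energy hM hm hcoer hT ((hgi n).sub (hgi k)) ((hRf n).sub (hRf k))
      (fun _ => rfl) hae ht
    rw [hprim t ht]
    refine hb.trans ?_
    rw [hδ_def]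
    simp only
    rw [← mul_add]
    have h1 : ‖R n (M u₀) - R k (M u₀)‖ ≤ ‖R n (M u₀) - u₀‖ + ‖R k (M u₀) - u₀‖ := by
      simpa only [dist_eq_norm] using dist_triangle_right (R n (M u₀)) (R k (M u₀)) u₀
    have h2 : ∫ s in 0..T, ‖R n (f s) - R k (f s)‖ ≤
        (∫ s in 0..T, ‖R n (f s) - N (f s)‖) + ∫ s in 0..T, ‖R k (f s) - N (f s)‖ := by
      rw [← intervalIntegral.integral_add ((hRf n).sub hNf).norm ((hRf k).sub hNf).norm]
      refine intervalIntegral.integral_mono_on hT ((hRf n).sub (hRf k)).norm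
        (((hRf n).sub hNf).norm.add ((hRf k).sub hNf).norm) fun s _ => ?_
      simpa only [dist_eq_norm] using dist_triangle_right (R n (f s)) (R k (f s)) (N (f s))
    have : 0 ≤ m⁻¹ * ‖M‖ := by positivity
    refine mul_le_mul_of_nonneg_left ?_ this
    linarith
  have hcauchy : UniformCauchySeqOn w atTop (Icc 0 T) := by
    rw [Metric.uniformCauchySeqOn_iff]
    intro ε hε
    obtain ⟨n₀, hn₀⟩ := eventually_atTop.1 (hδ.eventually_lt_const (half_pos hε))
    refine ⟨n₀, fun n hn k hk t ht => ?_⟩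
    rw [dist_eq_norm]
    have := hdiff n k t ht
    linarith [hn₀ n hn, hn₀ k hk]
  have hlim : ∀ t, ∃ x, t ∈ Icc 0 T → Tendsto (fun n => w n t) atTop (𝓝 x) := by
    intro t
    by_cases ht : t ∈ Icc 0 T
    · obtain ⟨x, hx⟩ := cauchySeq_tendsto_of_complete (hcauchy.cauchySeq ht)
      exact ⟨x, fun _ => hx⟩
    · exact ⟨0, fun h => absurd h ht⟩
  choose v hv using hlim
  have hunif : TendstoUniformlyOn w v atTop (Icc 0 T) :=
    hcauchy.tendstoUniformlyOn_of_tendsto fun t ht => hv t ht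
  have hwc : ∀ n, ContinuousOn (w n) (Icc 0 T) := fun n => by
    rw [← uIcc_of_le hT]
    exact continuousOn_const.add
      (intervalIntegral.continuousOn_primitive_interval' (hgi n) (by simp))
  refine ⟨v, hunif.continuousOn (.of_forall hwc), ?_, ?_⟩
  · filter_upwards [hwu, ae_restrict_mem measurableSet_Ioc] with t h1 htT
    refine tendsto_nhds_unique (hv t ⟨htT.1.le, htT.2⟩) ?_
    simp_rw [← h1]
    exact hres (u t)
  · refine tendsto_nhds_unique (hv 0 ⟨le_rfl, hT⟩) ?_
    simpa [hw_def] using hres u₀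

end Evolution

/-! ### Square integrable functions on a product and Carathéodory functions -/

section Measurability

/-- A map into a separable metric space is measurable if its distances to all points are, because
open sets are countable unions of balls. -/
theorem measurable_of_edist {α Y : Type*} [MeasurableSpace α] [PseudoEMetricSpace Y]
    [SecondCountableTopology Y] [MeasurableSpace Y] [BorelSpace Y] {f : α → Y}
    (h : ∀ y, Measurable fun a => edist (f a) y) : Measurable f := by
  refine measurable_of_isOpen fun U hU => ?_
  choose! r hr0 hr using EMetric.isOpen_iff.1 hU
  obtain ⟨S, hSc, hS⟩ := TopologicalSpace.isOpen_iUnion_countable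
    (fun y : U => Metric.eball (y : Y) (r y)) fun y => Metric.isOpen_eball
  have hU' : U = ⋃ y ∈ S, Metric.eball (y : Y) (r y) := by
    rw [hS]
    ext x
    simp only [mem_iUnion]
    exact ⟨fun hx => ⟨⟨x, hx⟩, Metric.mem_eball_self (hr0 x hx)⟩,
      fun ⟨y, hy⟩ => hr y y.2 hy⟩
  rw [hU', preimage_iUnion₂]
  exact .biUnion hSc fun y _ => measurableSet_lt (h y) measurable_const

/-- The identification of `L²(μ × ν)` with `L²(ν; L²(μ))`: the sections of a square integrable
function form a square integrable function with values in `L²(μ)`. -/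
theorem exists_memLp_sections {α β E : Type*} [MeasurableSpace α] [MeasurableSpace β]
    [NormedAddCommGroup E] [MeasurableSpace E] [BorelSpace E] [SecondCountableTopology E]
    {μ : Measure α} {ν : Measure β} [SFinite μ] [SFinite ν]
    [SecondCountableTopology (Lp E 2 μ)] {f : α × β → E}
    (hf : MemLp f 2 (μ.prod ν)) :
    ∃ u : β → Lp E 2 μ, MemLp u 2 ν ∧ ∀ᵐ b ∂ν, u b =ᵐ[μ] fun a => f (a, b) := by
  classical
  obtain ⟨f', hf'm, hff'⟩ := hf.1
  have hf' : MemLp f' 2 (μ.prod ν) := hf.ae_eq hff'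
  have hm : Measurable f' := hf'm.measurable
  have hsec : ∀ b, StronglyMeasurable fun a => f' (a, b) := fun b =>
    hf'm.comp_measurable measurable_prodMk_right
  have hswap : ∀ᵐ b ∂ν, ∀ᵐ a ∂μ, f (a, b) = f' (a, b) := by
    have : ∀ᵐ p ∂ν.prod μ, f p.swap = f' p.swap := by
      rw [← Measure.prod_swap] at hff'
      exact ae_of_ae_map measurable_swap.aemeasurable hff'
    exact Measure.ae_ae_of_ae_prod this
  have hsq : ∀ g : α → E, eLpNorm g 2 μ = (∫⁻ a, ‖g a‖ₑ ^ (2 : ℝ) ∂μ) ^ (1 / (2 : ℝ)) := fun g => by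
    simpa using eLpNorm_eq_lintegral_rpow_enorm_toReal (p := 2) (f := g) (μ := μ) two_ne_zero
      ENNReal.ofNat_ne_top
  have hdist : ∀ ψ : α → E, StronglyMeasurable ψ →
      Measurable fun b => eLpNorm (fun a => f' (a, b) - ψ a) 2 μ := by
    intro ψ hψ
    simp_rw [hsq]
    refine (Measurable.lintegral_prod_left' (f := fun p : α × β => ‖f' p - ψ p.1‖ₑ ^ (2 : ℝ))
      ?_).pow_const _
    exact (hm.sub (hψ.measurable.comp measurable_fst)).enorm.pow_const _
  have hnorm : Measurable fun b => eLpNorm (fun a => f' (a, b)) 2 μ := by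
    simpa using hdist 0 stronglyMeasurable_zero
  set S : Set β := {b | eLpNorm (fun a => f' (a, b)) 2 μ < ⊤} with hS
  have hSm : MeasurableSet S := measurableSet_lt hnorm measurable_const
  have hmem : ∀ b ∈ S, MemLp (fun a => f' (a, b)) 2 μ := fun b hb =>
    ⟨(hsec b).aestronglyMeasurable, hb⟩
  have htotal : ∫⁻ b, eLpNorm (fun a => f' (a, b)) 2 μ ^ (2 : ℝ) ∂ν < ⊤ := by
    have h1 := lintegral_rpow_enorm_lt_top_of_eLpNorm_lt_top two_ne_zero ENNReal.ofNat_ne_top hf'.2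
    rw [lintegral_prod_symm' _ (by simpa using hm.enorm.pow_const _)] at h1
    refine lt_of_eq_of_lt (lintegral_congr fun b => ?_) h1
    rw [hsq, ← ENNReal.rpow_mul]
    simp
  have hSae : ∀ᵐ b ∂ν, b ∈ S := by
    filter_upwards [ae_lt_top (hnorm.pow_const _) htotal.ne] with b hb
    exact (ENNReal.rpow_lt_top_iff_of_pos two_pos).1 hb
  -- The sections that fail to be square integrable, a null set of them, are replaced by `0`.
  let u : β → Lp E 2 μ := fun b => if hb : b ∈ S then (hmem b hb).toLp _ else 0
  have hu : ∀ b ∈ S, u b =ᵐ[μ] fun a => f' (a, b) := fun b hb => by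
    simp only [u, dif_pos hb]
    exact MemLp.coeFn_toLp _
  have hum : StronglyMeasurable u := by
    let _ : MeasurableSpace (Lp E 2 μ) := borel _
    have : BorelSpace (Lp E 2 μ) := ⟨rfl⟩
    refine Measurable.stronglyMeasurable (measurable_of_edist fun ψ => ?_)
    obtain ⟨ψ', hψ', hψψ'⟩ := (Lp.memLp ψ).1
    have h1 : (fun b => edist (u b) ψ) = fun b => if b ∈ S then
        eLpNorm (fun a => f' (a, b) - ψ' a) 2 μ else edist 0 ψ := by
      funext b
      split_ifs with hb
      · rw [Lp.edist_def]
        refine eLpNorm_congr_ae ?_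
        filter_upwards [hu b hb, hψψ'] with a h1 h2
        rw [Pi.sub_apply, h1, h2]
      · simp only [u, dif_neg hb]
    rw [h1]
    exact Measurable.ite hSm (hdist ψ' hψ') measurable_const
  refine ⟨u, ⟨hum.aestronglyMeasurable, ?_⟩, ?_⟩
  · rw [eLpNorm_lt_top_iff_lintegral_rpow_enorm_lt_top two_ne_zero ENNReal.ofNat_ne_top]
    refine lt_of_eq_of_lt (lintegral_congr_ae ?_) htotal
    filter_upwards [hSae] with b hb
    rw [Lp.enorm_def, eLpNorm_congr_ae (hu b hb)]
    simp
  · filter_upwards [hSae, hswap] with b hb hs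
    filter_upwards [hu b hb, hs] with a h1 h2
    rw [h1, h2]

/-- Composition of a Carathéodory function with a measurable function: approximate the inner
function by simple functions and use the continuity in the second variable. -/
theorem aemeasurable_caratheodory_comp {X Y Z : Type*} [MeasurableSpace X] {ρ : Measure X}
    [TopologicalSpace Y] [TopologicalSpace.PseudoMetrizableSpace Y]
    [TopologicalSpace Z] [TopologicalSpace.PseudoMetrizableSpace Z] [MeasurableSpace Z]
    [BorelSpace Z] {g : X → Y → Z} (hg : ∀ y, AEMeasurable (fun p => g p y) ρ)
    (hc : ∀ᵐ p ∂ρ, Continuous (g p)) {e : X → Y} (he : AEStronglyMeasurable e ρ) :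
    AEMeasurable (fun p => g p (e p)) ρ := by
  obtain ⟨e', he', hee'⟩ := he
  refine aemeasurable_of_tendsto_metrizable_ae (f := fun n p => g p (he'.approx n p)) atTop ?_ ?_
  · intro n
    have hcov : (⋃ y : (he'.approx n).range, he'.approx n ⁻¹' {(y : Y)}) = univ := by
      ext p; simp
    rw [← Measure.restrict_univ (μ := ρ), ← hcov,
      aemeasurable_iUnion_iff]
    intro y
    refine (hg y).restrict.congr ?_
    filter_upwards [ae_restrict_mem ((he'.approx n).measurableSet_fiber y)] with p hp
    rw [mem_preimage, mem_singleton_iff] at hp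
    rw [hp]
  · filter_upwards [hc, hee'] with p h1 h2
    rw [h2]
    exact (h1.tendsto _).comp (he'.tendsto_approx p)

end Measurability

/-! ### Weak and integral form of a scalar equation -/

section Scalar

/-- A weak form of the initial value problem `a' = -b`, `a(0) = a₀` implies its integral form. -/
theorem ae_eq_sub_integral_of_weak {T : ℝ} (hT : 0 ≤ T) {a b : ℝ → ℝ} {a₀ : ℝ}
    (ha : IntervalIntegrable a volume 0 T) (hb : IntervalIntegrable b volume 0 T)
    (h : ∀ ζ : ℝ → ℝ, ContDiff ℝ 1 ζ → ζ T = 0 →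
      -(∫ t in 0..T, deriv ζ t * a t) + ∫ t in 0..T, ζ t * b t = ζ 0 * a₀) :
    ∀ᵐ t ∂volume.restrict (Ioc 0 T), a t = a₀ - ∫ s in 0..t, b s := by
  set B : ℝ → ℝ := fun t => ∫ s in 0..t, b s with hB
  have hBac : AbsolutelyContinuousOnInterval B 0 T :=
    hb.absolutelyContinuousOnInterval_intervalIntegral (by simp)
  have hBi : IntervalIntegrable B volume 0 T := hBac.continuousOn.intervalIntegrable
  have hint : IntervalIntegrable (fun t => a t - (a₀ - B t)) volume 0 T :=
    ha.sub (intervalIntegrable_const.sub hBi)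
  have key : ∀ η : ℝ → ℝ, Continuous η → ∫ t in 0..T, η t * (a t - (a₀ - B t)) = 0 := by
    intro η hη
    -- Any continuous `η` is the derivative of an admissible `ζ`, as only `ζ T = 0` is required.
    set ζ : ℝ → ℝ := fun t => ∫ s in T..t, η s with hζ
    have hd : ∀ t, HasDerivAt ζ (η t) t := fun t => hη.integral_hasStrictDerivAt T t |>.hasDerivAt
    have hderiv : deriv ζ = η := funext fun t => (hd t).deriv
    have hζ1 : ContDiff ℝ 1 ζ :=
      contDiff_one_iff_deriv.2 ⟨fun t => (hd t).differentiableAt, hderiv ▸ hη⟩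
    have hζT : ζ T = 0 := intervalIntegral.integral_same
    have h1 := h ζ hζ1 hζT
    have hparts : ∫ t in 0..T, ζ t * b t = -∫ t in 0..T, η t * B t := by
      have h2 := AbsolutelyContinuousOnInterval.integral_mul_deriv_eq_deriv_mul
        (hζ1.contDiffOn (s := uIcc 0 T)).absolutelyContinuousOnInterval hBac
      have h3 : ∫ t in 0..T, ζ t * deriv B t = ∫ t in 0..T, ζ t * b t := by
        refine intervalIntegral.integral_congr_ae ?_
        filter_upwards [hb.ae_hasDerivAt_integral] with t ht ht'
        rw [(ht (uIoc_subset_uIcc ht') 0 (by simp)).deriv]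
      rw [← h3, h2, hζT, hderiv]
      simp [hB]
    have hζ0 : ζ 0 = -∫ t in 0..T, η t := intervalIntegral.integral_symm _ _
    rw [hparts, hderiv, hζ0] at h1
    have e1 : IntervalIntegrable (fun t => η t * a t) volume 0 T :=
      ha.continuousOn_mul hη.continuousOn
    have e2 : IntervalIntegrable (fun t => η t * B t) volume 0 T :=
      hBi.continuousOn_mul hη.continuousOn
    have e3 : IntervalIntegrable (fun t => η t * a₀) volume 0 T :=
      (hη.mul continuous_const).intervalIntegrable _ _
    have : ∀ t, η t * (a t - (a₀ - B t)) = η t * a t - η t * a₀ + η t * B t := fun t => by ring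
    simp_rw [this]
    rw [intervalIntegral.integral_add (e1.sub e3) e2, intervalIntegral.integral_sub e1 e3,
      intervalIntegral.integral_mul_const]
    linarith
  have h0 := isOpen_Ioo.ae_eq_zero_of_integral_contDiff_smul_eq_zero (U := Ioo (0 : ℝ) T)
    (f := fun t => a t - (a₀ - B t)) (μ := volume) ?_ ?_
  · rw [← restrict_Ioo_eq_restrict_Ioc]
    filter_upwards [(ae_restrict_iff' measurableSet_Ioo).2 h0] with t ht
    linarith
  · have := (intervalIntegrable_iff_integrableOn_Ioc_of_le hT).1 hint
    exact (this.mono_set Ioo_subset_Ioc_self).locallyIntegrableOn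
  · intro η hη _ hsupp
    have h1 := key η hη.continuous
    rw [intervalIntegral.integral_of_le hT] at h1
    rw [← h1]
    refine (setIntegral_eq_integral_of_forall_compl_eq_zero fun t ht => ?_).symm
    have : t ∉ tsupport η := fun h => ht (Ioo_subset_Ioc_self (hsupp h))
    rw [image_eq_zero_of_notMem_tsupport this, zero_smul]

end Scalar

/-! ### Multiplication operators -/

section Multiplication

theorem mulE_apply (A : Matrix (Fin 3) (Fin 3) ℝ) (ξ : E3) (i : Fin 3) :
    mulE A ξ i = ∑ k, A i k * ξ k := rfl

theorem norm_mulE_le {A : Matrix (Fin 3) (Fin 3) ℝ} {C : ℝ} (hC : ∀ i k, |A i k| ≤ C) (ξ : E3) :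
    ‖mulE A ξ‖ ≤ (∑ _i : Fin 3, ∑ _k : Fin 3, C) * ‖ξ‖ := by
  have h1 : mulE A ξ = ∑ i, mulE A ξ i • EuclideanSpace.single i (1 : ℝ) := by
    ext j; fin_cases j <;> simp [Fin.sum_univ_three]
  rw [h1, Finset.sum_mul]
  refine (norm_sum_le _ _).trans (Finset.sum_le_sum fun i _ => ?_)
  rw [norm_smul, PiLp.norm_single, norm_one, mul_one, mulE_apply, Finset.sum_mul]
  refine (norm_sum_le _ _).trans (Finset.sum_le_sum fun k _ => ?_)
  rw [norm_mul, Real.norm_eq_abs]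
  exact mul_le_mul (hC i k) (PiLp.norm_apply_le ξ k) (norm_nonneg _) ((abs_nonneg _).trans (hC i k))

/-- Multiplication by a bounded measurable matrix function is a bounded operator on `L²(Ω)³`. -/
theorem IsBoundedMeasurable.exists_mulOp {Ω : Set E3} {A : E3 → Matrix (Fin 3) (Fin 3) ℝ}
    (hA : IsBoundedMeasurable Ω A) (hΩ : MeasurableSet Ω) :
    ∃ M : L2Field Ω →L[ℝ] L2Field Ω, ∀ u : L2Field Ω,
      M u =ᵐ[volume.restrict Ω] fun x => mulE (A x) (u x) := by
  obtain ⟨C, hC⟩ := hA.bounded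
  set K : ℝ := ∑ _i : Fin 3, ∑ _k : Fin 3, C
  have hbound : ∀ u : L2Field Ω, ∀ᵐ x ∂volume.restrict Ω, ‖mulE (A x) (u x)‖ ≤ K * ‖u x‖ := by
    intro u
    filter_upwards [ae_restrict_mem hΩ] with x hx
    exact norm_mulE_le (hC x hx) _
  have hmem : ∀ u : L2Field Ω, MemLp (fun x => mulE (A x) (u x)) 2 (volume.restrict Ω) := by
    intro u
    refine (Lp.memLp u).of_le_mul ?_ (hbound u)
    refine AEMeasurable.aestronglyMeasurable ?_
    refine (MeasurableEquiv.toLp 2 (Fin 3 → ℝ)).measurable.comp_aemeasurable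
      (f := fun x i => mulE (A x) (u x) i) (aemeasurable_pi_lambda _ fun i => ?_)
    simp_rw [mulE_apply]
    refine Finset.aemeasurable_fun_sum _ fun k _ => (hA.aemeasurable i k).mul ?_
    exact (EuclideanSpace.proj (𝕜 := ℝ) k).continuous.measurable.comp_aemeasurable
      (Lp.aestronglyMeasurable u).aemeasurable
  let L : L2Field Ω →ₗ[ℝ] L2Field Ω :=
    { toFun := fun u => (hmem u).toLp _
      map_add' := by
        intro u v
        refine Lp.ext ?_
        filter_upwards [(hmem (u + v)).coeFn_toLp, (hmem u).coeFn_toLp, (hmem v).coeFn_toLp,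
          Lp.coeFn_add u v, Lp.coeFn_add ((hmem u).toLp _) ((hmem v).toLp _)] with x h1 h2 h3 h4 h5
        rw [h1, h5, Pi.add_apply, h2, h3, h4]
        exact map_add (Matrix.toEuclideanLin (A x)) _ _
      map_smul' := by
        intro c u
        refine Lp.ext ?_
        filter_upwards [(hmem (c • u)).coeFn_toLp, (hmem u).coeFn_toLp,
          Lp.coeFn_smul c u, Lp.coeFn_smul c ((hmem u).toLp _)] with x h1 h2 h4 h5
        rw [h1, RingHom.id_apply, h5, Pi.smul_apply, h2, h4]
        exact map_smul (Matrix.toEuclideanLin (A x)) _ _ }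
  refine ⟨L.mkContinuous K fun u => ?_, fun u => (hmem u).coeFn_toLp⟩
  refine Lp.norm_le_mul_norm_of_ae_le_mul ?_
  filter_upwards [(hmem u).coeFn_toLp, hbound u] with x h1 h2
  exact (congrArg norm h1).trans_le h2

theorem inner_mulOp {Ω : Set E3} {A : E3 → Matrix (Fin 3) (Fin 3) ℝ}
    {M : L2Field Ω →L[ℝ] L2Field Ω}
    (hM : ∀ u : L2Field Ω, M u =ᵐ[volume.restrict Ω] fun x => mulE (A x) (u x))
    (u v : L2Field Ω) : ⟪M u, v⟫ = ∫ x in Ω, ⟪mulE (A x) (u x), v x⟫ := by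
  rw [L2.inner_def]
  refine integral_congr_ae ?_
  filter_upwards [hM u] with x hx
  rw [hx]

theorem mulOp_symmetric {Ω : Set E3} (hΩ : MeasurableSet Ω) {A : E3 → Matrix (Fin 3) (Fin 3) ℝ}
    (hA : ∀ x ∈ Ω, (A x).IsSymm) {M : L2Field Ω →L[ℝ] L2Field Ω}
    (hM : ∀ u : L2Field Ω, M u =ᵐ[volume.restrict Ω] fun x => mulE (A x) (u x))
    (u v : L2Field Ω) : ⟪M u, v⟫ = ⟪u, M v⟫ := by
  rw [← real_inner_comm u, inner_mulOp hM, inner_mulOp hM]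
  refine setIntegral_congr_fun hΩ fun x hx => ?_
  have hs : (A x).IsHermitian := by
    rw [Matrix.IsHermitian, Matrix.conjTranspose_eq_transpose_of_trivial]; exact hA x hx
  rw [real_inner_comm (u x)]
  exact Matrix.isSymmetric_toEuclideanLin_iff.2 hs (u x) (v x)

theorem mulOp_coercive {Ω : Set E3} (hΩ : MeasurableSet Ω) {A : E3 → Matrix (Fin 3) (Fin 3) ℝ}
    {m : ℝ} (hA : ∀ x ∈ Ω, ∀ ξ : E3, m * ‖ξ‖ ^ 2 ≤ ⟪mulE (A x) ξ, ξ⟫)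
    {M : L2Field Ω →L[ℝ] L2Field Ω}
    (hM : ∀ u : L2Field Ω, M u =ᵐ[volume.restrict Ω] fun x => mulE (A x) (u x))
    (u : L2Field Ω) : m * ‖u‖ ^ 2 ≤ ⟪M u, u⟫ := by
  rw [← real_inner_self_eq_norm_sq, L2.inner_def, L2.inner_def, ← integral_const_mul]
  refine integral_mono_ae ((L2.integrable_inner u u).const_mul m) (L2.integrable_inner (M u) u) ?_
  filter_upwards [hM u, ae_restrict_mem hΩ] with x h1 h2
  rw [h1, real_inner_self_eq_norm_sq]
  exact hA x h2 _

end Multiplication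

/-! ### The Maxwell operator -/

section Curl

variable {Ω : Set E3}

theorem fderiv_component {φ : E3 → E3} (hφ : Differentiable ℝ φ) (i k : Fin 3) (x : E3) :
    fderiv ℝ (fun y => φ y k) x (EuclideanSpace.single i 1) = partialD φ i k x := by
  have := ((EuclideanSpace.proj (𝕜 := ℝ) k).hasFDerivAt.comp x (hφ x).hasFDerivAt).fderiv
  have h2 : fderiv ℝ (fun y => φ y k) x = (EuclideanSpace.proj (𝕜 := ℝ) k).comp (fderiv ℝ φ x) :=
    this
  rw [h2]
  rfl

theorem IsTestVector.continuous_partialD {φ : E3 → E3} (h : IsTestVector Ω φ) (i k : Fin 3) :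
    Continuous (partialD φ i k) := by
  have hd : Continuous (fderiv ℝ φ) := h.contDiff.continuous_fderiv (by simp)
  unfold partialD
  fun_prop

theorem IsTestVector.integrable_partialD_mul {φ χ : E3 → E3} (hφ : IsTestVector Ω φ)
    (hχ : IsTestVector Ω χ) (i k j : Fin 3) : Integrable (fun x => partialD φ i k x * χ x j) := by
  have hχc := hχ.contDiff.continuous
  refine ((hφ.continuous_partialD i k).mul (by fun_prop)).integrable_of_hasCompactSupport ?_
  refine hχ.hasCompactSupport.mono fun x hx => ?_
  contrapose! hx
  have : χ x = 0 := by simpa using hx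
  simp [this]

theorem IsTestVector.integral_mul_partialD {φ χ : E3 → E3} (hφ : IsTestVector Ω φ)
    (hχ : IsTestVector Ω χ) (i k j : Fin 3) :
    ∫ x, φ x k * partialD χ i j x = -∫ x, partialD φ i k x * χ x j := by
  have dφ := hφ.contDiff.differentiable (by simp)
  have dχ := hχ.contDiff.differentiable (by simp)
  have hφc := hφ.contDiff.continuous
  have hχc := hχ.contDiff.continuous
  have h := integral_mul_fderiv_eq_neg_fderiv_mul_of_integrable (μ := volume)
    (f := fun x : E3 => φ x k) (g := fun x => χ x j) (v := EuclideanSpace.single i 1)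
    (by simp_rw [fderiv_component dφ]; exact hφ.integrable_partialD_mul hχ i k j)
    (by
      simp_rw [fderiv_component dχ]
      simpa only [mul_comm] using hχ.integrable_partialD_mul hφ i j k)
    (by
      refine Continuous.integrable_of_hasCompactSupport (by fun_prop) ?_
      refine hχ.hasCompactSupport.mono fun x hx => ?_
      contrapose! hx
      have : χ x = 0 := by simpa using hx
      simp [this])
    (fun x _ => by have := dφ x; fun_prop) (fun x _ => by have := dχ x; fun_prop)
  simp_rw [fderiv_component dφ, fderiv_component dχ] at h
  exact h

theorem IsTestVector.eq_zero_of_notMem {φ : E3 → E3} (hφ : IsTestVector Ω φ) {x : E3}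
    (hx : x ∉ Ω) : φ x = 0 :=
  image_eq_zero_of_notMem_tsupport fun h => hx (hφ.tsupport_subset h)

/-- The curl is formally self-adjoint on test fields. -/
theorem IsTestVector.integral_inner_curl {φ χ : E3 → E3} (hφ : IsTestVector Ω φ)
    (hχ : IsTestVector Ω χ) :
    ∫ x in Ω, ⟪φ x, curl χ x⟫ = ∫ x in Ω, ⟪curl φ x, χ x⟫ := by
  rw [setIntegral_eq_integral_of_forall_compl_eq_zero
      (fun x hx => by rw [hφ.eq_zero_of_notMem hx, inner_zero_left]),
    setIntegral_eq_integral_of_forall_compl_eq_zero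
      (fun x hx => by rw [hχ.eq_zero_of_notMem hx, inner_zero_right])]
  have I := fun i k j => hφ.integrable_partialD_mul hχ i k j
  have J : ∀ i k j, Integrable fun x => φ x k * partialD χ i j x := fun i k j => by
    simpa only [mul_comm] using hχ.integrable_partialD_mul hφ i j k
  have h1 : ∀ x, ⟪φ x, curl χ x⟫ =
      (φ x 0 * partialD χ 1 2 x - φ x 0 * partialD χ 2 1 x) +
      (φ x 1 * partialD χ 2 0 x - φ x 1 * partialD χ 0 2 x) +
      (φ x 2 * partialD χ 0 1 x - φ x 2 * partialD χ 1 0 x) := fun x => by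
    simp [PiLp.inner_apply, Fin.sum_univ_three, curl]; ring
  have h2 : ∀ x, ⟪curl φ x, χ x⟫ =
      (partialD φ 1 2 x * χ x 0 - partialD φ 2 1 x * χ x 0) +
      (partialD φ 2 0 x * χ x 1 - partialD φ 0 2 x * χ x 1) +
      (partialD φ 0 1 x * χ x 2 - partialD φ 1 0 x * χ x 2) := fun x => by
    simp [PiLp.inner_apply, Fin.sum_univ_three, curl]; ring
  simp_rw [h1, h2]
  have key : ∀ {f₁ f₂ f₃ f₄ f₅ f₆ : E3 → ℝ}, Integrable f₁ → Integrable f₂ → Integrable f₃ →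
      Integrable f₄ → Integrable f₅ → Integrable f₆ →
      ∫ x, ((f₁ x - f₂ x) + (f₃ x - f₄ x) + (f₅ x - f₆ x)) =
        (∫ x, f₁ x) - (∫ x, f₂ x) + ((∫ x, f₃ x) - ∫ x, f₄ x) + ((∫ x, f₅ x) - ∫ x, f₆ x) := by
    intro f₁ f₂ f₃ f₄ f₅ f₆ i₁ i₂ i₃ i₄ i₅ i₆
    exact (integral_add ((i₁.sub i₂).add (i₃.sub i₄)) (i₅.sub i₆)).trans (congrArg₂ (· + ·)
      ((integral_add (i₁.sub i₂) (i₃.sub i₄)).trans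
        (congrArg₂ (· + ·) (integral_sub i₁ i₂) (integral_sub i₃ i₄))) (integral_sub i₅ i₆))
  rw [key (J 1 0 2) (J 2 0 1) (J 2 1 0) (J 0 1 2) (J 0 2 1) (J 1 2 0),
    key (I 1 2 0) (I 2 1 0) (I 2 0 1) (I 0 2 1) (I 0 1 2) (I 1 0 2)]
  simp_rw [hφ.integral_mul_partialD hχ]
  ring

/-- A test field as an element of `V`. -/
noncomputable def IsTestVector.toHCurl {φ : E3 → E3} (hφ : IsTestVector Ω φ) : HCurl Ω :=
  ⟨WithLp.toLp 2 (hφ.memLp.toLp φ, hφ.memLp_curl.toLp (curl φ)), by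
    intro χ hχ
    have h1 : ∫ x in Ω, ⟪hφ.memLp.toLp φ x, curl χ x⟫ = ∫ x in Ω, ⟪φ x, curl χ x⟫ := by
      refine integral_congr_ae ?_
      filter_upwards [hφ.memLp.coeFn_toLp] with x hx
      rw [hx]
    have h2 : ∫ x in Ω, ⟪hφ.memLp_curl.toLp (curl φ) x, χ x⟫ = ∫ x in Ω, ⟪curl φ x, χ x⟫ := by
      refine integral_congr_ae ?_
      filter_upwards [hφ.memLp_curl.coeFn_toLp] with x hx
      rw [hx]
    exact h1.trans ((hφ.integral_inner_curl hχ).trans h2.symm)⟩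

theorem inner_toLp_right {w : E3 → E3} (hw : MemLp w 2 (volume.restrict Ω)) (u : L2Field Ω) :
    ⟪u, hw.toLp w⟫ = ∫ x in Ω, ⟪u x, w x⟫ := by
  rw [L2.inner_def]
  refine integral_congr_ae ?_
  filter_upwards [hw.coeFn_toLp] with x hx
  rw [hx]

theorem IsTestVector.toHCurl_mem {φ : E3 → E3} (hφ : IsTestVector Ω φ) :
    hφ.toHCurl ∈ HCurlZero Ω := by
  intro ψ
  rw [real_inner_comm (toField ψ), real_inner_comm (wcurl ψ)]
  have h := ψ.2 φ hφ
  have h1 := inner_toLp_right hφ.memLp_curl (toField ψ)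
  have h2 := inner_toLp_right hφ.memLp (wcurl ψ)
  exact h1.trans (h.trans h2.symm)

/-- The weak curl in terms of the inner product of `L²(Ω)³`. -/
theorem isWeakCurl_iff_inner {u F : L2Field Ω} : IsWeakCurl Ω u F ↔
    ∀ φ, ∀ hφ : IsTestVector Ω φ, ⟪u, wcurl hφ.toHCurl⟫ = ⟪F, toField hφ.toHCurl⟫ := by
  refine forall₂_congr fun φ hφ => ?_
  have h1 := inner_toLp_right hφ.memLp_curl u
  have h2 := inner_toLp_right hφ.memLp F
  rw [← h1, ← h2]
  rfl

/-- Test fields are total in `L²(Ω)³`. -/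
theorem eq_zero_of_inner_test (hΩ : IsOpen Ω) {v : L2Field Ω}
    (h : ∀ φ, ∀ hφ : IsTestVector Ω φ, ⟪v, toField hφ.toHCurl⟫ = 0) : v = 0 := by
  refine Lp.ext ?_
  refine EventuallyEq.trans ?_ (Lp.coeFn_zero E3 2 (volume.restrict Ω)).symm
  have hloc : LocallyIntegrableOn v Ω volume :=
    locallyIntegrableOn_of_locallyIntegrable_restrict
      ((Lp.memLp v).locallyIntegrable one_le_two)
  have := hΩ.ae_eq_zero_of_integral_contDiff_smul_eq_zero hloc ?_
  · exact (ae_restrict_iff' hΩ.measurableSet).2 this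
  intro g hg hgc hgs
  refine ext_inner_right ℝ fun c => ?_
  rw [inner_zero_left]
  have htest : IsTestVector Ω fun x => g x • c :=
    ⟨hg.smul contDiff_const, hgc.smul_right, (tsupport_smul_subset_left _ _).trans hgs⟩
  have h1 := h _ htest
  have h2 : ∫ x in Ω, ⟪v x, g x • c⟫ = 0 := (inner_toLp_right htest.memLp v).symm.trans h1
  have h3 : ∫ x, g x • v x = ∫ x in Ω, g x • v x := by
    refine (setIntegral_eq_integral_of_forall_compl_eq_zero fun x hx => ?_).symm
    rw [image_eq_zero_of_notMem_tsupport fun h => hx (hgs h), zero_smul]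
  have hint : Integrable (fun x => g x • v x) (volume.restrict Ω) := by
    have hgm : MemLp g 2 (volume.restrict Ω) := hg.continuous.memLp_of_hasCompactSupport hgc
    exact memLp_one_iff_integrable.1 ((Lp.memLp v).smul hgm)
  rw [h3, real_inner_comm, ← integral_inner hint, ← h2]
  refine integral_congr_ae (.of_forall fun x => ?_)
  simp only
  rw [real_inner_comm, real_inner_smul_left, real_inner_smul_right]

/-- The graph of the Maxwell operator `(e, h) ↦ (curl h, -curl e)` with domain `V₀ × V`. -/
def maxwellGraph (Ω : Set E3) : Submodule ℝ
    (WithLp 2 (L2Field Ω × L2Field Ω) × WithLp 2 (L2Field Ω × L2Field Ω)) where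
  carrier := {p | ∃ φ ∈ HCurlZero Ω, ∃ ψ : HCurl Ω,
    p.1 = WithLp.toLp 2 (toField φ, toField ψ) ∧ p.2 = WithLp.toLp 2 (wcurl ψ, -wcurl φ)}
  zero_mem' := by
    refine ⟨0, zero_mem _, 0, rfl, ?_⟩
    change _ = WithLp.toLp 2 ((0 : L2Field Ω), -(0 : L2Field Ω))
    rw [neg_zero]
    rfl
  add_mem' := by
    rintro p q ⟨φ, hφ, ψ, h1, h2⟩ ⟨φ', hφ', ψ', h1', h2'⟩
    refine ⟨φ + φ', add_mem hφ hφ', ψ + ψ', ?_, ?_⟩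
    · rw [Prod.fst_add, h1, h1']; rfl
    · rw [Prod.snd_add, h2, h2']
      change _ = WithLp.toLp 2 (wcurl ψ + wcurl ψ', -(wcurl φ + wcurl φ'))
      rw [neg_add]; rfl
  smul_mem' := by
    rintro c p ⟨φ, hφ, ψ, h1, h2⟩
    refine ⟨c • φ, Submodule.smul_mem _ c hφ, c • ψ, ?_, ?_⟩
    · rw [Prod.smul_fst, h1]; rfl
    · rw [Prod.smul_snd, h2]
      change _ = WithLp.toLp 2 (c • wcurl ψ, -(c • wcurl φ))
      rw [← smul_neg]; rfl

theorem mk_mem_maxwellGraph {φ : HCurl Ω} (hφ : φ ∈ HCurlZero Ω) (ψ : HCurl Ω) :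
    (WithLp.toLp 2 (toField φ, toField ψ), WithLp.toLp 2 (wcurl ψ, -wcurl φ)) ∈ maxwellGraph Ω :=
  ⟨φ, hφ, ψ, rfl, rfl⟩

/-- The definition of `V₀` is the boundary condition that makes the Maxwell operator
skew-adjoint, for an arbitrary open set. -/
theorem isSkewAdjoint_maxwellGraph : IsSkewAdjoint (maxwellGraph Ω) := by
  intro x y
  constructor
  · rintro ⟨φ, hφ, ψ, h1, h2⟩ a b ⟨φ', hφ', ψ', h1', h2'⟩
    simp only at h1 h2 h1' h2'
    rw [h1, h2, h1', h2']
    simp only [WithLp.prod_inner_apply, inner_neg_left, inner_neg_right]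
    have e1 := hφ ψ'
    have e2 := hφ' ψ
    rw [real_inner_comm, real_inner_comm (wcurl ψ)] at e2
    linarith
  · intro h
    have hV₀ : ∀ φ ∈ HCurlZero Ω, ⟪y.fst, toField φ⟫ = ⟪x.snd, wcurl φ⟫ := by
      intro φ hφ
      have := h _ _ (mk_mem_maxwellGraph hφ 0)
      simp only [WithLp.prod_inner_apply, inner_neg_right] at this
      have z1 : toField (0 : HCurl Ω) = 0 := rfl
      have z2 : wcurl (0 : HCurl Ω) = 0 := rfl
      rw [z1, z2, inner_zero_right, inner_zero_right] at this
      change ⟪y.fst, _⟫ + 0 + (0 + -⟪x.snd, _⟫) = 0 at this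
      linarith
    have hV : ∀ ψ : HCurl Ω, ⟪-y.snd, toField ψ⟫ = ⟪x.fst, wcurl ψ⟫ := by
      intro ψ
      have := h _ _ (mk_mem_maxwellGraph (zero_mem _) ψ)
      simp only [WithLp.prod_inner_apply, inner_neg_right] at this
      have z1 : toField (0 : HCurl Ω) = 0 := rfl
      have z2 : wcurl (0 : HCurl Ω) = 0 := rfl
      rw [z1, z2, inner_zero_right, inner_zero_right] at this
      change 0 + ⟪y.snd, _⟫ + (⟪x.fst, _⟫ + -0) = 0 at this
      rw [inner_neg_left]
      linarith
    have hw1 : IsWeakCurl Ω x.snd y.fst := isWeakCurl_iff_inner.2 fun φ hφ =>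
      (hV₀ _ hφ.toHCurl_mem).symm
    have hw2 : IsWeakCurl Ω x.fst (-y.snd) := isWeakCurl_iff_inner.2 fun φ hφ => (hV _).symm
    refine ⟨⟨WithLp.toLp 2 (x.fst, -y.snd), hw2⟩, fun ψ => hV ψ,
      ⟨WithLp.toLp 2 (x.snd, y.fst), hw1⟩, rfl, ?_⟩
    change y = WithLp.toLp 2 (y.fst, - -y.snd)
    rw [neg_neg]
    rfl

theorem dense_domain_maxwellGraph (hΩ : IsOpen Ω) :
    Dense {a | ∃ b, (a, b) ∈ maxwellGraph Ω} := by
  set D := (maxwellGraph Ω).map (LinearMap.fst ℝ _ _) with hD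
  have hDset : {a | ∃ b, (a, b) ∈ maxwellGraph Ω} = (D : Set _) := by
    ext a; simp [hD]
  rw [hDset, Submodule.dense_iff_topologicalClosure_eq_top,
    Submodule.topologicalClosure_eq_top_iff, Submodule.eq_bot_iff]
  intro p hp
  have hmem : ∀ φ ∈ HCurlZero Ω, ∀ ψ : HCurl Ω,
      ⟪p.fst, toField φ⟫ + ⟪p.snd, toField ψ⟫ = 0 := by
    intro φ hφ ψ
    exact (Submodule.mem_orthogonal' _ _).1 hp _ ⟨_, mk_mem_maxwellGraph hφ ψ, rfl⟩
  have h1 : p.fst = 0 := eq_zero_of_inner_test hΩ fun φ hφ => by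
    have := hmem _ hφ.toHCurl_mem 0
    have z1 : toField (0 : HCurl Ω) = 0 := rfl
    rwa [z1, inner_zero_right, add_zero] at this
  have h2 : p.snd = 0 := eq_zero_of_inner_test hΩ fun φ hφ => by
    have := hmem 0 (zero_mem _) hφ.toHCurl
    have z1 : toField (0 : HCurl Ω) = 0 := rfl
    rwa [z1, inner_zero_right, zero_add] at this
  exact WithLp.ofLp_injective 2 (Prod.ext h1 h2)

end Curl

/-! ### The weak formulation in integral form -/

section WeakForm

variable {Ω : Set E3} {T : ℝ}

theorem memLp_two_of_continuous {Y : Type*} [NormedAddCommGroup Y] {F : ℝ → Y}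
    (hF : Continuous F) : MemLp F 2 (volume.restrict (Ioo 0 T)) := by
  obtain ⟨C, hC⟩ := (isCompact_Icc (a := 0) (b := T)).exists_bound_of_continuousOn hF.continuousOn
  refine MemLp.of_bound hF.aestronglyMeasurable C ?_
  filter_upwards [ae_restrict_mem measurableSet_Ioo] with t ht
  exact hC t (Ioo_subset_Icc_self ht)

theorem isDistribDeriv_smul_const (hT : 0 ≤ T) {Y : Type*} [NormedAddCommGroup Y]
    [NormedSpace ℝ Y] [CompleteSpace Y] {ζ : ℝ → ℝ} (hζ : ContDiff ℝ 1 ζ) (y : Y) :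
    IsDistribDeriv T (fun t => ζ t • y) fun t => deriv ζ t • y := by
  intro θ hθ _ hsupp
  have h0 : θ 0 = 0 := image_eq_zero_of_notMem_tsupport fun h => lt_irrefl _ (hsupp h).1
  have hT0 : θ T = 0 := image_eq_zero_of_notMem_tsupport fun h => lt_irrefl _ (hsupp h).2
  have hθ1 : ContDiff ℝ 1 θ := hθ.of_le (by exact_mod_cast le_top)
  simp_rw [smul_smul]
  have h1 : ∀ a : ℝ → ℝ, ∫ t in Ioo 0 T, a t • y = (∫ t in 0..T, a t) • y := fun a => by
    rw [intervalIntegral.integral_of_le hT, integral_Ioc_eq_integral_Ioo, integral_smul_const]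
  rw [h1, h1, ← neg_smul]
  congr 1
  have := intervalIntegral.integral_mul_deriv_eq_deriv_mul (a := 0) (b := T)
    (fun t _ => (hζ.differentiable one_ne_zero t).hasDerivAt)
    (fun t _ => (hθ1.differentiable one_ne_zero t).hasDerivAt)
    ((hζ.continuous_deriv le_rfl).intervalIntegrable _ _)
    ((hθ1.continuous_deriv le_rfl).intervalIntegrable _ _)
  rw [h0, hT0, mul_zero, mul_zero, sub_zero, zero_sub] at this
  simpa only [mul_comm] using this

/-- Products of a scalar `C¹` function of time that vanishes at `T` with a fixed element of `V`
are admissible test fields. -/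
theorem isTestField_smul (hT : 0 ≤ T) {ζ : ℝ → ℝ} (hζ : ContDiff ℝ 1 ζ) (hζT : ζ T = 0)
    (φ : HCurl Ω) :
    IsTestField Ω T (fun t => ζ t • φ) (fun t => deriv ζ t • toField φ)
      fun t => ζ t • toField φ where
  memLp := memLp_two_of_continuous (hζ.continuous.smul continuous_const)
  memLp_deriv := memLp_two_of_continuous ((hζ.continuous_deriv le_rfl).smul continuous_const)
  deriv := isDistribDeriv_smul_const hT hζ (toField φ)
  continuousOn := (hζ.continuous.smul continuous_const).continuousOn
  ae_eq := .of_forall fun _ => rfl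
  final := by simp only [hζT, zero_smul]

theorem setIntegral_inner_smul {u : L2Field Ω} {v : E3 → E3}
    (huv : u =ᵐ[volume.restrict Ω] v) (c : ℝ) (ψ : L2Field Ω) :
    ∫ x in Ω, ⟪v x, (c • ψ) x⟫ = c * ⟪u, ψ⟫ := by
  rw [← real_inner_smul_right, L2.inner_def]
  refine integral_congr_ae ?_
  filter_upwards [huv] with x hx
  rw [hx]

theorem setIntegral_inner_mulE_smul {A : E3 → Matrix (Fin 3) (Fin 3) ℝ}
    {M : L2Field Ω →L[ℝ] L2Field Ω}
    (hM : ∀ u : L2Field Ω, M u =ᵐ[volume.restrict Ω] fun x => mulE (A x) (u x))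
    {u : L2Field Ω} {v : E3 → E3} (huv : u =ᵐ[volume.restrict Ω] v) (c : ℝ) (ψ : L2Field Ω) :
    ∫ x in Ω, ⟪mulE (A x) (v x), (c • ψ) x⟫ = c * ⟪M u, ψ⟫ := by
  refine setIntegral_inner_smul ?_ c ψ
  filter_upwards [hM u, huv] with x h1 h2
  rw [h1, h2]

theorem intervalIntegrable_inner_const {H : Type*} [NormedAddCommGroup H]
    [InnerProductSpace ℝ H] {a b : ℝ} {u : ℝ → H} (hu : IntervalIntegrable u volume a b) (ψ : H) :
    IntervalIntegrable (fun t => ⟪u t, ψ⟫) volume a b :=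
  ⟨hu.1.inner_const ψ, hu.2.inner_const ψ⟩

theorem intervalIntegrable_of_memLp {H : Type*} [NormedAddCommGroup H] (hT : 0 ≤ T) {u : ℝ → H}
    (hu : MemLp u 2 (volume.restrict (Ioo 0 T))) : IntervalIntegrable u volume 0 T := by
  rw [intervalIntegrable_iff_integrableOn_Ioo_of_le hT]
  exact hu.integrable one_le_two

/-- Integral form of Ampère's law, tested with a fixed element of `V₀`. -/
theorem IsWeakSolution.ampere_integral {ε μ : E3 → Matrix (Fin 3) (Fin 3) ℝ}
    {j₀ : E3 × ℝ → E3} {j₁ : E3 × ℝ → E3 → E3} {e₀ h₀ : L2Field Ω} {e h : E3 × ℝ → E3}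
    (hsol : IsWeakSolution Ω T ε μ j₀ j₁ e₀ h₀ e h) (hT : 0 ≤ T)
    {M : L2Field Ω →L[ℝ] L2Field Ω}
    (hM : ∀ u : L2Field Ω, M u =ᵐ[volume.restrict Ω] fun x => mulE (ε x) (u x))
    {u v f : ℝ → L2Field Ω} (hu : IntervalIntegrable u volume 0 T)
    (hv : IntervalIntegrable v volume 0 T) (hf : IntervalIntegrable f volume 0 T)
    (hue : ∀ᵐ t ∂volume.restrict (Ioo 0 T), u t =ᵐ[volume.restrict Ω] fun x => e (x, t))
    (hvh : ∀ᵐ t ∂volume.restrict (Ioo 0 T), v t =ᵐ[volume.restrict Ω] fun x => h (x, t))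
    (hfj : ∀ᵐ t ∂volume.restrict (Ioo 0 T), f t =ᵐ[volume.restrict Ω]
      fun x => j₀ (x, t) + j₁ (x, t) (e (x, t)))
    {φ : HCurl Ω} (hφ : φ ∈ HCurlZero Ω) :
    ∀ᵐ t ∂volume.restrict (Ioc 0 T), ⟪M (u t), toField φ⟫ =
      ⟪M e₀, toField φ⟫ - ∫ s in 0..t, (-⟪v s, wcurl φ⟫ + ⟪f s, toField φ⟫) := by
  have hMu : IntervalIntegrable (fun t => M (u t)) volume 0 T :=
    ⟨M.integrable_comp hu.1, M.integrable_comp hu.2⟩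
  refine ae_eq_sub_integral_of_weak hT (intervalIntegrable_inner_const hMu _)
    ((intervalIntegrable_inner_const hv _).neg.add (intervalIntegrable_inner_const hf _))
    fun ζ hζ hζT => ?_
  have key := hsol.ampere _ _ _ (isTestField_smul hT hζ hζT φ)
    (.of_forall fun t => Submodule.smul_mem _ _ hφ)
  have i1 : ∫ t in Ioo 0 T, ∫ x in Ω, ⟪mulE (ε x) (e (x, t)), (deriv ζ t • toField φ) x⟫ =
      ∫ t in 0..T, deriv ζ t * ⟪M (u t), toField φ⟫ := by
    rw [intervalIntegral.integral_of_le hT, integral_Ioc_eq_integral_Ioo]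
    refine integral_congr_ae ?_
    filter_upwards [hue] with t ht
    exact setIntegral_inner_mulE_smul hM ht _ _
  have i2 : ∫ t in Ioo 0 T, ∫ x in Ω, (-⟪h (x, t), wcurl (ζ t • φ) x⟫
      + ⟪j₀ (x, t) + j₁ (x, t) (e (x, t)), toField (ζ t • φ) x⟫) =
      ∫ t in 0..T, ζ t * (-⟪v t, wcurl φ⟫ + ⟪f t, toField φ⟫) := by
    rw [intervalIntegral.integral_of_le hT, integral_Ioc_eq_integral_Ioo]
    refine integral_congr_ae ?_
    filter_upwards [hvh, hfj] with t h1 h2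
    have e1 := setIntegral_inner_smul h1 (ζ t) (wcurl φ)
    have e2 := setIntegral_inner_smul h2 (ζ t) (toField φ)
    have I1 : Integrable (fun x => ⟪h (x, t), (ζ t • wcurl φ) x⟫) (volume.restrict Ω) := by
      refine (L2.integrable_inner (𝕜 := ℝ) (v t) (ζ t • wcurl φ)).congr ?_
      filter_upwards [h1] with x hx
      rw [hx]
    have I2 : Integrable (fun x => ⟪j₀ (x, t) + j₁ (x, t) (e (x, t)), (ζ t • toField φ) x⟫)
        (volume.restrict Ω) := by
      refine (L2.integrable_inner (𝕜 := ℝ) (f t) (ζ t • toField φ)).congr ?_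
      filter_upwards [h2] with x hx
      rw [hx]
    refine (integral_add I1.neg I2).trans ?_
    rw [e2, mul_add, mul_neg, ← e1, ← integral_neg]
    rfl
  have i3 := setIntegral_inner_mulE_smul hM (ae_eq_refl e₀) (ζ 0) (toField φ)
  rw [i1, i2] at key
  exact key.trans i3

/-- Integral form of Faraday's law, tested with a fixed element of `V`. -/
theorem IsWeakSolution.faraday_integral {ε μ : E3 → Matrix (Fin 3) (Fin 3) ℝ}
    {j₀ : E3 × ℝ → E3} {j₁ : E3 × ℝ → E3 → E3} {e₀ h₀ : L2Field Ω} {e h : E3 × ℝ → E3}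
    (hsol : IsWeakSolution Ω T ε μ j₀ j₁ e₀ h₀ e h) (hT : 0 ≤ T)
    {M : L2Field Ω →L[ℝ] L2Field Ω}
    (hM : ∀ u : L2Field Ω, M u =ᵐ[volume.restrict Ω] fun x => mulE (μ x) (u x))
    {u v : ℝ → L2Field Ω} (hu : IntervalIntegrable u volume 0 T)
    (hv : IntervalIntegrable v volume 0 T)
    (hue : ∀ᵐ t ∂volume.restrict (Ioo 0 T), u t =ᵐ[volume.restrict Ω] fun x => e (x, t))
    (hvh : ∀ᵐ t ∂volume.restrict (Ioo 0 T), v t =ᵐ[volume.restrict Ω] fun x => h (x, t))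
    (ψ : HCurl Ω) :
    ∀ᵐ t ∂volume.restrict (Ioc 0 T), ⟪M (v t), toField ψ⟫ =
      ⟪M h₀, toField ψ⟫ - ∫ s in 0..t, ⟪u s, wcurl ψ⟫ := by
  have hMv : IntervalIntegrable (fun t => M (v t)) volume 0 T :=
    ⟨M.integrable_comp hv.1, M.integrable_comp hv.2⟩
  refine ae_eq_sub_integral_of_weak hT (intervalIntegrable_inner_const hMv _)
    (intervalIntegrable_inner_const hu _) fun ζ hζ hζT => ?_
  have key := hsol.faraday _ _ _ (isTestField_smul hT hζ hζT ψ)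
  have i1 : ∫ t in Ioo 0 T, ∫ x in Ω, ⟪mulE (μ x) (h (x, t)), (deriv ζ t • toField ψ) x⟫ =
      ∫ t in 0..T, deriv ζ t * ⟪M (v t), toField ψ⟫ := by
    rw [intervalIntegral.integral_of_le hT, integral_Ioc_eq_integral_Ioo]
    refine integral_congr_ae ?_
    filter_upwards [hvh] with t ht
    exact setIntegral_inner_mulE_smul hM ht _ _
  have i2 : ∫ t in Ioo 0 T, ∫ x in Ω, ⟪e (x, t), wcurl (ζ t • ψ) x⟫ =
      ∫ t in 0..T, ζ t * ⟪u t, wcurl ψ⟫ := by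
    rw [intervalIntegral.integral_of_le hT, integral_Ioc_eq_integral_Ioo]
    refine integral_congr_ae ?_
    filter_upwards [hue] with t h1
    exact setIntegral_inner_smul h1 (ζ t) (wcurl ψ)
  have i3 := setIntegral_inner_mulE_smul hM (ae_eq_refl h₀) (ζ 0) (toField ψ)
  rw [i1, i2] at key
  exact key.trans i3

/-- The current density `j₀ + j₁(·, e)` belongs to `L²(Q_T)³`. -/
theorem memLp_current (hΩ : MeasurableSet Ω) {j₀ : E3 × ℝ → E3} {j₁ : E3 × ℝ → E3 → E3}
    (hj₀ : MemLp j₀ 2 (volume.restrict (cylinder Ω T)))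
    (hj₁ : IsCaratheodory (cylinder Ω T) j₁) {c : ℝ}
    (hc : ∀ p ∈ cylinder Ω T, ∀ ξ : E3, ‖j₁ p ξ‖ ≤ c * ‖ξ‖) {e : E3 × ℝ → E3}
    (he : MemLp e 2 (volume.restrict (cylinder Ω T))) :
    MemLp (fun p => j₀ p + j₁ p (e p)) 2 (volume.restrict (cylinder Ω T)) := by
  refine hj₀.add (he.of_le_mul (c := c) ?_ ?_)
  · exact (aemeasurable_caratheodory_comp hj₁.aemeasurable hj₁.continuous
      he.1).aestronglyMeasurable
  · filter_upwards [ae_restrict_mem (hΩ.prod measurableSet_Ioo)] with p hp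
    exact hc p hp _

/-- Sections of a square integrable field on the cylinder. -/
theorem exists_sections {w : E3 × ℝ → E3} (hw : MemLp w 2 (volume.restrict (cylinder Ω T))) :
    ∃ u : ℝ → L2Field Ω, MemLp u 2 (volume.restrict (Ioo 0 T)) ∧
      ∀ᵐ t ∂volume.restrict (Ioo 0 T), u t =ᵐ[volume.restrict Ω] fun x => w (x, t) := by
  rw [cylinder, Measure.volume_eq_prod, ← Measure.prod_restrict] at hw
  -- This makes the second countability of `L²(Ω)³` available to instance search.
  have : Fact ((2 : ENNReal) ≠ ⊤) := ⟨ENNReal.ofNat_ne_top⟩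
  exact exists_memLp_sections hw

end WeakForm

end Maxwell

open Maxwell in
theorem theorem3p1
    (Ω : Set Maxwell.E3) (hΩ : IsOpen Ω) (T : ℝ) (hT : 0 < T)
    (ε μ : Maxwell.E3 → Matrix (Fin 3) (Fin 3) ℝ)
    (hε : Maxwell.IsBoundedMeasurable Ω ε) (hμ : Maxwell.IsBoundedMeasurable Ω μ)
    (j₀ : Maxwell.E3 × ℝ → Maxwell.E3)
    (hj₀ : MemLp j₀ 2 (volume.restrict (Maxwell.cylinder Ω T)))
    (j₁ : Maxwell.E3 × ℝ → Maxwell.E3 → Maxwell.E3)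
    (hj₁ : Maxwell.IsCaratheodory (Maxwell.cylinder Ω T) j₁)
    (hgrowth : ∃ c₁ : ℝ, 0 < c₁ ∧
      ∀ p ∈ Maxwell.cylinder Ω T, ∀ ξ : Maxwell.E3, ‖j₁ p ξ‖ ≤ c₁ * ‖ξ‖)
    (e₀ h₀ : Maxwell.L2Field Ω)
    (hε_symm : ∀ x ∈ Ω, (ε x).IsSymm) (hμ_symm : ∀ x ∈ Ω, (μ x).IsSymm)
    (hε_ell : Maxwell.IsUniformlyElliptic Ω ε) (hμ_ell : Maxwell.IsUniformlyElliptic Ω μ)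
    (e h : Maxwell.E3 × ℝ → Maxwell.E3)
    (hsol : Maxwell.IsWeakSolution Ω T ε μ j₀ j₁ e₀ h₀ e h) :
    ∃ ehat hhat : ℝ → Maxwell.L2Field Ω,
      ContinuousOn ehat (Icc 0 T) ∧ ContinuousOn hhat (Icc 0 T) ∧
      (∀ᵐ t ∂(volume.restrict (Ioo 0 T)),
        ∀ᵐ x ∂(volume.restrict Ω), ehat t x = e (x, t)) ∧
      (∀ᵐ t ∂(volume.restrict (Ioo 0 T)),
        ∀ᵐ x ∂(volume.restrict Ω), hhat t x = h (x, t)) ∧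
      ehat 0 = e₀ ∧ hhat 0 = h₀ := by
  have hΩm := hΩ.measurableSet
  have hT0 := hT.le
  have : Fact ((2 : ENNReal) ≠ ⊤) := ⟨ENNReal.ofNat_ne_top⟩
  have : SecondCountableTopology (L2Field Ω) := inferInstance
  have : SecondCountableTopology (WithLp 2 (L2Field Ω × L2Field Ω)) :=
    (WithLp.prodContinuousLinearEquiv 2 ℝ (L2Field Ω)
      (L2Field Ω)).toHomeomorph.secondCountableTopology
  obtain ⟨c, _, hc⟩ := hgrowth
  obtain ⟨Mε, hMε⟩ := hε.exists_mulOp hΩm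
  obtain ⟨Mμ, hMμ⟩ := hμ.exists_mulOp hΩm
  obtain ⟨a, ha, hεa⟩ := hε_ell
  obtain ⟨b, hb, hμb⟩ := hμ_ell
  obtain ⟨ue, hue, huee⟩ := exists_sections hsol.memLp_e
  obtain ⟨uh, huh, huhh⟩ := exists_sections hsol.memLp_h
  obtain ⟨uj, huj, hujj⟩ := exists_sections (memLp_current hΩm hj₀ hj₁ hc hsol.memLp_e)
  replace hue := intervalIntegrable_of_memLp hT0 hue
  replace huh := intervalIntegrable_of_memLp hT0 huh
  replace huj := intervalIntegrable_of_memLp hT0 huj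
  have hpair : ∀ {p q : ℝ → L2Field Ω}, IntervalIntegrable p volume 0 T →
      IntervalIntegrable q volume 0 T →
      IntervalIntegrable (fun t => WithLp.toLp 2 (p t, q t)) volume 0 T := by
    intro p q hp hq
    let J := ((WithLp.prodContinuousLinearEquiv 2 ℝ (L2Field Ω) (L2Field Ω)).symm :
      L2Field Ω × L2Field Ω →L[ℝ] WithLp 2 (L2Field Ω × L2Field Ω))
    exact ⟨J.integrable_comp (hp.1.prodMk hq.1), J.integrable_comp (hp.2.prodMk hq.2)⟩
  let M : WithLp 2 (L2Field Ω × L2Field Ω) →L[ℝ] WithLp 2 (L2Field Ω × L2Field Ω) :=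
    ((WithLp.prodContinuousLinearEquiv 2 ℝ (L2Field Ω) (L2Field Ω)).symm :
      L2Field Ω × L2Field Ω →L[ℝ] WithLp 2 (L2Field Ω × L2Field Ω)).comp
      ((Mε.prodMap Mμ).comp (WithLp.prodContinuousLinearEquiv 2 ℝ (L2Field Ω) (L2Field Ω) :
        WithLp 2 (L2Field Ω × L2Field Ω) →L[ℝ] L2Field Ω × L2Field Ω))
  have hMin : ∀ p q, ⟪M p, q⟫ = ⟪Mε p.fst, q.fst⟫ + ⟪Mμ p.snd, q.snd⟫ := fun p q =>
    WithLp.prod_inner_apply _ _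
  have hMsymm : ∀ p q, ⟪M p, q⟫ = ⟪p, M q⟫ := by
    intro p q
    rw [← real_inner_comm p, hMin, hMin, mulOp_symmetric hΩm hε_symm hMε,
      mulOp_symmetric hΩm hμ_symm hMμ, real_inner_comm p.fst, real_inner_comm p.snd]
  have hMcoer : ∀ p, min a b * ‖p‖ ^ 2 ≤ ⟪M p, p⟫ := by
    intro p
    rw [WithLp.prod_norm_sq_eq_of_L2, hMin, mul_add]
    refine add_le_add ?_ ?_
    · exact (mul_le_mul_of_nonneg_right (min_le_left _ _) (sq_nonneg _)).trans
        (mulOp_coercive hΩm hεa hMε _)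
    · exact (mul_le_mul_of_nonneg_right (min_le_right _ _) (sq_nonneg _)).trans
        (mulOp_coercive hΩm hμb hMμ _)
  obtain ⟨v, hvc, hvu, hv0⟩ := exists_continuous_representative (M := M)
    isSkewAdjoint_maxwellGraph hMsymm (lt_min ha hb) hMcoer (dense_domain_maxwellGraph hΩ) hT0
    (u := fun t => WithLp.toLp 2 (ue t, uh t)) (f := fun t => WithLp.toLp 2 (uj t, 0))
    (u₀ := WithLp.toLp 2 (e₀, h₀)) (hpair hue huh)
    (hpair huj (intervalIntegrable_const (c := (0 : L2Field Ω)))) (by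
      rintro _ _ ⟨φ, hφ, ψ, rfl, rfl⟩
      filter_upwards [hsol.ampere_integral hT0 hMε hue huh huj huee huhh hujj hφ,
        hsol.faraday_integral hT0 hMμ hue huh huee huhh ψ, ae_restrict_mem measurableSet_Ioc]
        with t h1 h2 htT
      have hsub : uIcc 0 t ⊆ uIcc 0 T := by
        rw [uIcc_of_le htT.1.le, uIcc_of_le hT0]; exact Icc_subset_Icc_right htT.2
      have I1 := (((intervalIntegrable_inner_const huh (wcurl φ)).neg.add
        (intervalIntegrable_inner_const huj (toField φ))).mono_set hsub)
      have I2 := ((intervalIntegrable_inner_const hue (wcurl ψ)).mono_set hsub)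
      rw [hMin, hMin]
      refine (congrArg₂ (· + ·) h1 h2).trans ?_
      have h3 := intervalIntegral.integral_add I1 I2
      simp only [Pi.neg_apply] at h3
      have h4 : ∀ s, ⟪WithLp.toLp 2 (ue s, uh s), WithLp.toLp 2 (wcurl ψ, -wcurl φ)⟫ +
          ⟪WithLp.toLp 2 (uj s, (0 : L2Field Ω)), WithLp.toLp 2 (toField φ, toField ψ)⟫ =
          -⟪uh s, wcurl φ⟫ + ⟪uj s, toField φ⟫ + ⟪ue s, wcurl ψ⟫ := by
        intro s
        simp only [WithLp.prod_inner_apply, inner_neg_right, inner_zero_left]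
        ring
      simp_rw [h4]
      rw [h3]
      exact sub_add_sub_comm _ _ _ _)
  rw [← restrict_Ioo_eq_restrict_Ioc] at hvu
  refine ⟨fun t => (v t).fst, fun t => (v t).snd,
    (WithLp.fstL 2 ℝ (L2Field Ω) (L2Field Ω)).continuous.comp_continuousOn hvc,
    (WithLp.sndL 2 ℝ (L2Field Ω) (L2Field Ω)).continuous.comp_continuousOn hvc, ?_, ?_, ?_, ?_⟩
  · filter_upwards [hvu, huee] with t h1 h2
    rw [h1]
    exact h2
  · filter_upwards [hvu, huhh] with t h1 h2
    rw [h1]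
    exact h2
  · exact congrArg WithLp.fst hv0
  · exact congrArg WithLp.snd hv0
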